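/- \textbf{Setting.} Let $t_1^*,\dots,t_n^*\in\mathbb{R}^3$ be distinct, and let $E\subseteq[n]\times[n]$ be the edge list of a graph $G$ on $[n]$ without loops, in which $ij$ and $ji$ are never both listed. Let $E=E_g\sqcup E_b$ be a partition into good and bad edges. Put $\gamma_{ij}^*=(t_i^*-t_j^*)/\|t_i^*-t_j^*\|$ for $i\ne j$. Each $ij\in E$ carries a unit vector $\gamma_{ij}$, with $\gamma_{ij}=\gamma_{ij}^*$ for $ij\in E_g$ and $\gamma_{ij}$ arbitrary for $ij\in E_b$. For a subspace $V$ let $P_V$ be the orthogonal projection onto $V$. For $ij\in E$ let $$f_{ij}(x,y)=\begin{cases}\|P_{\gamma_{ij}^\perp}(x-y)\|,&\langle\gamma_{ij},x-y\rangle>1,\\ \|x-y-\gamma_{ij}\|,&\langle\gamma_{ij},x-y\rangle\le1.\end{cases}$$ The LUD problem is to minimize $\sum_{ij\in E}f_{ij}(t_i,t_j)$ over all $\{t_i\}_{i=1}^n\subset\mathbb{R}^3$ with $\sum_i t_i=0$. The oracle problem is the same minimization restricted to families of the form $t_i=ct_i^*+t$ with $c\in\mathbb{R}$, $t\in\mathbb{R}^3$.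 Assume that the oracle problem has a solution $(c,t)=(c^*,t_s)$ and that $c^*$ is unique. Let $E_{gl}=\{ij\in E_g:\|t_i^*-t_j^*\|>1/c^*\}$ (read as $c^*\|t_i^*-t_j^*\|>1$) and $E_{gl}^c=E\setminus E_{gl}$. A finite set $A\subset\mathbb{R}^3$ is \emph{$c$-well-distributed with respect to} $(x,y)$ if $\frac1{|A|}\sum_{a\in A}\|P_{\mathrm{span}\{a-x,a-y\}^\perp}h\|\ge c\,\|P_{(x-y)^\perp}h\|$ for all $h\in\mathbb{R}^3$. The family $\{t_i^*\}$ is \emph{$c$-well-distributed along} a graph $H$ on $[n]$ if, for all $i\neq j$, the set of those $t_k^*$ for which $k$ is adjacent in $H$ to both $i$ and $j$ is $c$-well-distributed with respect to $(t_i^*,t_j^*)$. \textbf{Theorem.} Let $p,\beta,\epsilon_0,\epsilon_1,c_1\in(0,1]$ and $c_0\ge1$, and suppose that the following good-shape condition holds: \begin{enumerate} \item $G$ is $p$-typical: it is connected, every vertex has degree between $\frac12np$ and $2np$, and any two distinct vertices have between $\frac12np^2$ and $2np^2$ common neighbours; \item for every ordered pair $i\ne j$ there are at least $n-\epsilon_1n$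 indices $k\ne i,j$ with $1-\langle\gamma_{ij}^*,\gamma_{ik}^*\rangle\ge\beta^2$ and $1-\langle\gamma_{ij}^*,\gamma_{jk}^*\rangle\ge\beta^2$; \item $\|t_i^*-t_j^*\|\le c_0\mu$ for all $i\neq j$, where $\mu=\binom n2^{-1}\sum_{i<j}\|t_i^*-t_j^*\|$; \item every vertex is incident to at most $\epsilon_0n$ edges of $E_{gl}^c$; \item $\{t_i^*\}$ is $c_1$-well-distributed along $G$ and along the complete graph $K_n$; \item no three of the points $t_i^*$ are collinear. \end{enumerate} Suppose also that $$\epsilon_0\le\min\left\{\frac{\beta c_1p}{2^{22}c_0^3},\ \frac{\beta c_1^2p}{2^{20}c_0},\ \frac{c_1p^2}{16}\right\}\quad\text{and}\quad\epsilon_1\le\min\left\{\frac1{144c_0},\frac1{96}\right\}.$$ Then the good-long-dominance condition holds: for all $\varepsilon_1,\dots,\varepsilon_n\in\mathbb{R}^3$ with $\sum_i\varepsilon_i=0$ and $\sum_i\langle\varepsilon_i,t_i^*\rangle=0$, $$\sum_{ij\in E_{gl}}\|P_{\gamma_{ij}^{*\perp}}(\varepsilon_i-\varepsilon_j)\|\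 \ge\sum_{ij\in E_{gl}^c}\|\varepsilon_i-\varepsilon_j\|.$$ Moreover, the LUD problem has exactly one solution $\{\hat t_i\}_{i=1}^n$, namely $\hat t_i=c^*t_i^*+t_s$ for all $i\in[n]$. -/

import Mathlib

noncomputable section

namespace LUD

/-- Euclidean three-space. -/
abbrev E3 := EuclideanSpace ℝ (Fin 3)

/-- The vector `P_{γ^⊥} v`: orthogonal projection of `v` onto the orthogonal complement of `γ`. -/
def projPerp (γ v : E3) : E3 := ((Submodule.span ℝ {γ})ᗮ).starProjection v

/-- The true direction `(x - y) / ‖x - y‖` of the pair of locations `x`, `y`. -/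
def direction (x y : E3) : E3 := ‖x - y‖⁻¹ • (x - y)

/-- The undirected graph with an edge between `i` and `j` whenever `ij` or `ji` is listed in `E`. -/
def graphOf {n : ℕ} (E : Finset (Fin n × Fin n)) : SimpleGraph (Fin n) :=
  SimpleGraph.fromRel (fun i j => (i, j) ∈ E)

/-- The deterministic setting: distinct ground truth locations `t_i^*`; a list of edges
`E ⊆ [n] × [n]`, in which `ij` and `ji` are never both present (in particular there are no loops),
partitioned into good and bad edges; and a unit vector `γ_ij` for each edge `ij`, which is the true
direction on the good edges and arbitrary on the bad ones (values off `E` are never used). -/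
structure CameraNetwork (n : ℕ) where
  loc : Fin n → E3
  loc_injective : Function.Injective loc
  Eg : Finset (Fin n × Fin n)
  Eb : Finset (Fin n × Fin n)
  disjoint : Disjoint Eg Eb
  no_repetition : ∀ i j, (i, j) ∈ Eg ∪ Eb → (j, i) ∉ Eg ∪ Eb
  γ : Fin n → Fin n → E3
  norm_γ : ∀ i j, (i, j) ∈ Eg ∪ Eb → ‖γ i j‖ = 1
  γ_good : ∀ i j, (i, j) ∈ Eg → γ i j = direction (loc i) (loc j)

/-! ### The LUD problem and the oracle problem -/

open Classical in
/-- The summand `f_ij(x, y)`, as a function of `γ = γ_ij`. -/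
def edgeCost (γ x y : E3) : ℝ :=
  if 1 < inner ℝ γ (x - y) then ‖projPerp γ (x - y)‖ else ‖x - y - γ‖

namespace CameraNetwork

variable {n : ℕ} (N : CameraNetwork n)

/-- All the edges. -/
def E : Finset (Fin n × Fin n) := N.Eg ∪ N.Eb

/-- The true direction `γ_ij^*`. -/
def γstar (i j : Fin n) : E3 := direction (N.loc i) (N.loc j)

/-- The objective function of LUD, with the auxiliary variables eliminated. -/
def objective (t : Fin n → E3) : ℝ := ∑ e ∈ N.E, edgeCost (N.γ e.1 e.2) (t e.1) (t e.2)

/-- `t` solves LUD: it minimizes the objective among the centred families of locations. -/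
def IsLUDSolution (t : Fin n → E3) : Prop :=
  ∑ i, t i = 0 ∧ ∀ u : Fin n → E3, ∑ i, u i = 0 → N.objective t ≤ N.objective u

/-- `(c, s)` solves the oracle problem: it minimizes the objective among the centred families of
the form `c t_i^* + s`, where `c` is any real number and `s` any vector. -/
def IsOracleSolution (c : ℝ) (s : E3) : Prop :=
  ∑ i, (c • N.loc i + s) = 0 ∧
    ∀ (c' : ℝ) (s' : E3), ∑ i, (c' • N.loc i + s') = 0 →
      N.objective (fun i => c • N.loc i + s) ≤ N.objective (fun i => c' • N.loc i + s')

/-! ### Good and long edges, and the good-long-dominance condition -/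

open Classical in
/-- The good and long edges with respect to the scale `c`: those `ij ∈ E_g` with
`‖t_i^* - t_j^*‖ > 1 / c`. (The product form also forces `c > 0`.) -/
def Egl (c : ℝ) : Finset (Fin n × Fin n) :=
  N.Eg.filter (fun e => 1 < c * ‖N.loc e.1 - N.loc e.2‖)

/-- The complement of the good and long edges within `E`. -/
def EglCompl (c : ℝ) : Finset (Fin n × Fin n) := N.E \ N.Egl c

/-- The good-long-dominance condition. -/
def GoodLongDominance (c : ℝ) : Prop :=
  ∀ ε : Fin n → E3, ∑ i, ε i = 0 → ∑ i, inner ℝ (ε i) (N.loc i) = 0 →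
    ∑ e ∈ N.EglCompl c, ‖ε e.1 - ε e.2‖ ≤
      ∑ e ∈ N.Egl c, ‖projPerp (N.γstar e.1 e.2) (ε e.1 - ε e.2)‖

end CameraNetwork

/-! ### The good-shape condition -/

/-- `p`-typical graphs on `n` vertices. -/
structure IsTypical {n : ℕ} (G : SimpleGraph (Fin n)) (p : ℝ) : Prop where
  connected : G.Connected
  degree : ∀ i, (1 / 2) * n * p ≤ ((G.neighborSet i).ncard : ℝ) ∧
    ((G.neighborSet i).ncard : ℝ) ≤ 2 * n * p
  codegree : ∀ i j, i ≠ j → (1 / 2) * n * p ^ 2 ≤ ((G.commonNeighbors i j).ncard : ℝ) ∧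
    ((G.commonNeighbors i j).ncard : ℝ) ≤ 2 * n * p ^ 2

/-- The finite set `A` of points is `c`-well-distributed with respect to `(x, y)`. -/
def IsWellDistributed (c : ℝ) (A : Finset E3) (x y : E3) : Prop :=
  ∀ h : E3, c * ‖projPerp (x - y) h‖ ≤
    (1 / (A.card : ℝ)) *
      ∑ a ∈ A, ‖((Submodule.span ℝ {a - x, a - y})ᗮ).starProjection h‖

open Classical in
/-- The family `t` of locations is `c`-well-distributed along the graph `G`. -/
def IsWellDistributedAlong {n : ℕ} (c : ℝ) (t : Fin n → E3) (G : SimpleGraph (Fin n)) : Prop :=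
  ∀ i j, i ≠ j →
    IsWellDistributed c
      ((Finset.univ.filter (fun k => G.Adj i k ∧ G.Adj j k)).image t) (t i) (t j)

/-- The mean distance `μ` over the edges of the complete graph. -/
def meanDist {n : ℕ} (t : Fin n → E3) : ℝ :=
  (∑ e ∈ Finset.univ.filter (fun e : Fin n × Fin n => e.1 < e.2), ‖t e.1 - t e.2‖) /
    (n.choose 2 : ℝ)

/-- The good-shape condition with the parameters `p, β, ε₀, ε₁, c₀, c₁`, where the good and long
edges are taken with respect to the scale `c`. -/
structure GoodShape {n : ℕ} (N : CameraNetwork n) (c p β ε₀ ε₁ c₀ c₁ : ℝ) : Prop where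
  typical : IsTypical (graphOf N.E) p
  large_angles : ∀ i j, i ≠ j →
    (n : ℝ) - ε₁ * n ≤
      (({k | k ≠ i ∧ k ≠ j ∧ β ^ 2 ≤ 1 - inner ℝ (N.γstar i j) (N.γstar i k) ∧
        β ^ 2 ≤ 1 - inner ℝ (N.γstar i j) (N.γstar j k)} : Set (Fin n)).ncard : ℝ)
  dist_le : ∀ i j, i ≠ j → ‖N.loc i - N.loc j‖ ≤ c₀ * meanDist N.loc
  max_degree : ∀ i, (((graphOf (N.EglCompl c)).neighborSet i).ncard : ℝ) ≤ ε₀ * n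
  well_distributed : IsWellDistributedAlong c₁ N.loc (graphOf N.E)
  well_distributed_complete : IsWellDistributedAlong c₁ N.loc (⊤ : SimpleGraph (Fin n))
  not_collinear : ∀ i j k, i ≠ j → i ≠ k → j ≠ k →
    ¬ Collinear ℝ ({N.loc i, N.loc j, N.loc k} : Set E3)

end LUD

end

/-!
By convexity a competitor for LUD may be compared with the oracle solution on a short initial piece
of the segment joining them. There every good long edge costs exactly the perpendicular part of the
perturbation, so after splitting the displacement into a dilation with translation, which the oracle
controls, and a perturbation `ε` orthogonal to it, uniqueness follows from good-long dominance with
strict inequality for `ε ≠ 0`.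

For dominance, a difference `ε_i - ε_j` is split into its part perpendicular to `t_i^* - t_j^*` and
a relative stretching of that vector. Two sides of a triangle with wide angles have nearly the same
relative stretching, up to the perpendicular parts along the three sides. Passing through the pairs
`ij`, `im`, `ik`, `km`, `kl`, this compares the stretchings of any two pairs; since their weighted
mean vanishes, every single stretching is bounded by averaged perpendicular parts. Finally,
well-distributedness bounds the perpendicular part along `ij` by those along the paths `ikj`, and
each edge lies on few of the paths that join the ends of the sparse bad edges.
-/

namespace LUD

section Rejection

variable {V : Type*} [NormedAddCommGroup V] [InnerProductSpace ℝ V]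

/-- The rejection of vectors from `a`, that is, the orthogonal projection onto `aᗮ`; this is
`projPerp a`, as a continuous linear map and in any inner product space. -/
noncomputable def rejection (a : V) : V →L[ℝ] V := (Submodule.span ℝ {a})ᗮ.starProjection

lemma rejection_apply (a v : V) :
    rejection a v = v - (inner ℝ a v / ‖a‖ ^ 2) • a := by
  rw [rejection, Submodule.starProjection_orthogonal_val, Submodule.starProjection_singleton]
  simp only [RCLike.ofReal_real_eq_id, id_eq]

lemma norm_rejection_le (a v : V) : ‖rejection a v‖ ≤ ‖v‖ :=
  Submodule.norm_starProjection_apply_le _ _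

lemma rejection_self (a : V) : rejection a a = 0 :=
  Submodule.starProjection_orthogonalComplement_singleton_eq_zero a

lemma rejection_smul_left {r : ℝ} (hr : r ≠ 0) (a v : V) :
    rejection (r • a) v = rejection a v := by
  simp only [rejection, Submodule.span_singleton_smul_eq (IsUnit.mk0 r hr) a]

lemma rejection_neg_left (a v : V) : rejection (-a) v = rejection a v := by
  rw [← neg_one_smul ℝ a, rejection_smul_left (by norm_num)]

lemma inner_rejection_left (a v : V) : inner ℝ (rejection a v) a = 0 :=
  Submodule.inner_left_of_mem_orthogonal (Submodule.mem_span_singleton_self a)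
    (Submodule.starProjection_apply_mem _ v)

lemma norm_sq_rejection {a : V} (ha : ‖a‖ = 1) (v : V) :
    ‖rejection a v‖ ^ 2 = ‖v‖ ^ 2 - inner ℝ a v ^ 2 := by
  rw [rejection_apply, ha, norm_sub_sq_real, inner_smul_right, norm_smul, ha, real_inner_comm,
    Real.norm_eq_abs, mul_one, sq_abs]
  ring

lemma norm_starProjection_orthogonal_le_norm_rejection {U : Submodule ℝ V}
    [U.HasOrthogonalProjection] {a : V} (ha : a ∈ U) (v : V) :
    ‖Uᗮ.starProjection v‖ ≤ ‖rejection a v‖ := by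
  have hle := Submodule.orthogonal_le ((Submodule.span_singleton_le_iff_mem a U).2 ha)
  rw [← Submodule.starProjection_comp_starProjection_of_le hle]
  exact Submodule.norm_starProjection_apply_le _ _

/-- In the plane of a triangle with sides `a`, `b` and `b - a`, rejecting from the third side
compares the relative stretchings of the first two. -/
lemma abs_sub_mul_norm_rejection_le (a b x y : V) (δ₁ δ₂ δ₃ : ℝ) :
    |δ₁ - δ₂| * ‖rejection (b - a) a‖ ≤
      ‖x - δ₁ • a‖ + ‖y - δ₂ • b‖ + ‖(y - x) - δ₃ • (b - a)‖ := by
  have key : (δ₁ - δ₂) • a =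
      (y - δ₂ • b) - (x - δ₁ • a) - ((y - x) - δ₃ • (b - a)) - (δ₃ - δ₂) • (b - a) := by
    module
  calc |δ₁ - δ₂| * ‖rejection (b - a) a‖ = ‖rejection (b - a) ((δ₁ - δ₂) • a)‖ := by
        rw [map_smul, norm_smul, Real.norm_eq_abs]
    _ = ‖rejection (b - a) ((y - δ₂ • b) - (x - δ₁ • a) - ((y - x) - δ₃ • (b - a)))‖ := by
        rw [key, map_sub _ _ ((δ₃ - δ₂) • (b - a)), map_smul _ (δ₃ - δ₂), rejection_self, smul_zero,
          sub_zero]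
    _ ≤ ‖(y - δ₂ • b) - (x - δ₁ • a) - ((y - x) - δ₃ • (b - a))‖ := norm_rejection_le _ _
    _ ≤ ‖y - δ₂ • b‖ + ‖x - δ₁ • a‖ + ‖(y - x) - δ₃ • (b - a)‖ :=
        (norm_sub_le _ _).trans (by gcongr; exact norm_sub_le _ _)
    _ = _ := by ring

end Rejection

/-- The sum of the values of `f` at the three sides of the triangle `ijk`. -/
def triangleSum {ι : Type*} (f : ι → ι → ℝ) (i j k : ι) : ℝ := f i j + f i k + f j k

section Motion

variable {V ι : Type*} [NormedAddCommGroup V] [InnerProductSpace ℝ V] (t h : ι → V)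

/-- The non-parallel part of the motion of the pair `ij`, when the points `t` move with
velocities `h`. -/
noncomputable def perpPart (i j : ι) : ℝ := ‖rejection (t i - t j) (h i - h j)‖

/-- The relative stretching of the pair `ij`, when the points `t` move with velocities `h`. -/
noncomputable def stretching (i j : ι) : ℝ := inner ℝ (t i - t j) (h i - h j) / ‖t i - t j‖ ^ 2

/-- The lines `ik` and `jk` make angles with the line `ij` whose sines are at least `β`. With both
sides multiplied by `‖t i - t j‖`, this needs no side condition on degenerate triangles. -/
def HasWideAngles (β : ℝ) (i j k : ι) : Prop :=
  β * ‖t i - t j‖ ≤ ‖rejection (t i - t k) (t i - t j)‖ ∧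
    β * ‖t i - t j‖ ≤ ‖rejection (t j - t k) (t i - t j)‖

lemma perpPart_nonneg (i j : ι) : 0 ≤ perpPart t h i j := norm_nonneg _

lemma perpPart_self (i : ι) : perpPart t h i i = 0 := by
  rw [perpPart, sub_self (h i), map_zero, norm_zero]

lemma perpPart_comm (i j : ι) : perpPart t h i j = perpPart t h j i := by
  rw [perpPart, perpPart, ← neg_sub (t j), ← neg_sub (h j), rejection_neg_left, map_neg, norm_neg]

lemma perpPart_eq_norm_sub (i j : ι) :
    perpPart t h i j = ‖(h i - h j) - stretching t h i j • (t i - t j)‖ := by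
  rw [perpPart, rejection_apply, stretching]

lemma stretching_comm (i j : ι) : stretching t h i j = stretching t h j i := by
  rw [stretching, stretching, ← neg_sub (t j), ← neg_sub (h j), inner_neg_neg, norm_neg]

lemma triangleSum_perpPart_nonneg (i j k : ι) : 0 ≤ triangleSum (perpPart t h) i j k :=
  add_nonneg (add_nonneg (norm_nonneg _) (norm_nonneg _)) (norm_nonneg _)

lemma norm_sub_le_perpPart_add (i j : ι) :
    ‖h i - h j‖ ≤ perpPart t h i j + ‖t i - t j‖ * |stretching t h i j| := by
  rw [perpPart_eq_norm_sub, mul_comm, ← Real.norm_eq_abs, ← norm_smul]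
  simpa only [sub_add_cancel] using norm_add_le ((h i - h j) - stretching t h i j • (t i - t j))
    (stretching t h i j • (t i - t j))

variable {t} {β : ℝ} {i j k l m : ι}

lemma HasWideAngles.symm (hw : HasWideAngles t β i j k) : HasWideAngles t β j i k := by
  rw [HasWideAngles, ← neg_sub (t i), norm_neg, map_neg, map_neg, norm_neg, norm_neg]
  exact ⟨hw.2, hw.1⟩

lemma HasWideAngles.mul_abs_stretching_sub_le (hw : HasWideAngles t β i j k) :
    β * (‖t i - t j‖ * |stretching t h i j - stretching t h i k|) ≤
      triangleSum (perpPart t h) i j k := by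
  have hcompare := abs_sub_mul_norm_rejection_le (t i - t j) (t i - t k) (h i - h j) (h i - h k)
    (stretching t h i j) (stretching t h i k) (stretching t h j k)
  rw [sub_sub_sub_cancel_left, sub_sub_sub_cancel_left, ← perpPart_eq_norm_sub,
    ← perpPart_eq_norm_sub, ← perpPart_eq_norm_sub] at hcompare
  have := mul_le_mul_of_nonneg_left hw.2 (abs_nonneg (stretching t h i j - stretching t h i k))
  rw [triangleSum]
  linarith

/-- The bound for the pairs `ij` and `kl` that results from the chain of pairs
`ij`, `im`, `ik`, `km`, `kl`. -/
noncomputable def chainBound (t h : ι → V) (i j k l m : ι) : ℝ :=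
  ‖t i - t k‖ * ‖t k - t l‖ * triangleSum (perpPart t h) i j m +
    2 * (‖t i - t j‖ * ‖t k - t l‖ * triangleSum (perpPart t h) i k m) +
    ‖t i - t j‖ * ‖t i - t k‖ * triangleSum (perpPart t h) k l m

lemma chainBound_nonneg (i j k l m : ι) : 0 ≤ chainBound t h i j k l m := by
  have := triangleSum_perpPart_nonneg t h
  have h₁ := this i j m
  have h₂ := this i k m
  have h₃ := this k l m
  unfold chainBound
  positivity

lemma mul_abs_stretching_sub_le_chainBound (hij : HasWideAngles t β i j m)
    (hik : HasWideAngles t β i k m) (hkl : HasWideAngles t β k l m) (hβ : 0 ≤ β) :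
    β * (‖t i - t j‖ * ‖t i - t k‖ * ‖t k - t l‖ * |stretching t h i j - stretching t h k l|) ≤
      chainBound t h i j k l m := by
  have h_ij := hij.mul_abs_stretching_sub_le h
  have h_ik := hik.mul_abs_stretching_sub_le h
  have h_kl := hkl.mul_abs_stretching_sub_le h
  have h_ki := hik.symm.mul_abs_stretching_sub_le h
  have hτ : triangleSum (perpPart t h) k i m = triangleSum (perpPart t h) i k m := by
    rw [triangleSum, triangleSum, perpPart_comm t h k i]; ring
  rw [hτ, norm_sub_rev, stretching_comm t h k i] at h_ki
  have hchain : |stretching t h i j - stretching t h k l| ≤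
      |stretching t h i j - stretching t h i m| + |stretching t h i k - stretching t h i m| +
        |stretching t h i k - stretching t h k m| + |stretching t h k l - stretching t h k m| := by
    grind
  calc _ ≤ β * (‖t i - t j‖ * ‖t i - t k‖ * ‖t k - t l‖ *
        (|stretching t h i j - stretching t h i m| + |stretching t h i k - stretching t h i m| +
          |stretching t h i k - stretching t h k m| +
          |stretching t h k l - stretching t h k m|)) := by gcongr
    _ = ‖t i - t k‖ * ‖t k - t l‖ *
          (β * (‖t i - t j‖ * |stretching t h i j - stretching t h i m|)) +
        (‖t i - t j‖ * ‖t k - t l‖ *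
          (β * (‖t i - t k‖ * |stretching t h i k - stretching t h i m|)) +
        ‖t i - t j‖ * ‖t k - t l‖ *
          (β * (‖t i - t k‖ * |stretching t h i k - stretching t h k m|))) +
        ‖t i - t j‖ * ‖t i - t k‖ *
          (β * (‖t k - t l‖ * |stretching t h k l - stretching t h k m|)) := by ring
    _ ≤ chainBound t h i j k l m := by rw [chainBound, two_mul]; gcongr

lemma pow_four_mul_chainBound_le {r C : ℝ} (hD : ∀ i j, r ^ 2 * ‖t i - t j‖ ≤ C)
    (i j k l m : ι) :
    r ^ 4 * chainBound t h i j k l m ≤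
      r ^ 2 * C * (‖t k - t l‖ * triangleSum (perpPart t h) i j m) +
        C ^ 2 * (2 * triangleSum (perpPart t h) i k m + triangleSum (perpPart t h) k l m) := by
  have hijm := triangleSum_perpPart_nonneg t h i j m
  have hikm := triangleSum_perpPart_nonneg t h i k m
  have hklm := triangleSum_perpPart_nonneg t h k l m
  have hC : 0 ≤ C := le_trans (by positivity) (hD i j)
  calc r ^ 4 * chainBound t h i j k l m
      = r ^ 2 * (r ^ 2 * ‖t i - t k‖) * (‖t k - t l‖ * triangleSum (perpPart t h) i j m) +
        2 * ((r ^ 2 * ‖t i - t j‖) * (r ^ 2 * ‖t k - t l‖) * triangleSum (perpPart t h) i k m) +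
        (r ^ 2 * ‖t i - t j‖) * (r ^ 2 * ‖t i - t k‖) * triangleSum (perpPart t h) k l m := by
        rw [chainBound]; ring
    _ ≤ r ^ 2 * C * (‖t k - t l‖ * triangleSum (perpPart t h) i j m) +
        2 * (C * C * triangleSum (perpPart t h) i k m) +
        C * C * triangleSum (perpPart t h) k l m := by
        gcongr <;> exact hD _ _
    _ = _ := by ring

end Motion

section Averaging

variable {V ι : Type*} [NormedAddCommGroup V] [InnerProductSpace ℝ V] [Fintype ι] {t h : ι → V}

lemma sum_sq_mul_stretching (hh : ∑ i, h i = 0) (hl : ∑ i, inner ℝ (h i) (t i) = 0) :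
    ∑ i, ∑ j, ‖t i - t j‖ ^ 2 * stretching t h i j = 0 := by
  have hpt (i j : ι) : ‖t i - t j‖ ^ 2 * stretching t h i j =
      inner ℝ (h i) (t i) - inner ℝ (h j) (t i) - (inner ℝ (h i) (t j) - inner ℝ (h j) (t j)) := by
    rw [stretching, ← inner_sub_left, ← inner_sub_left, ← inner_sub_right, real_inner_comm]
    rcases eq_or_ne (t i - t j) 0 with h0 | h0
    · rw [h0, inner_zero_right, zero_div, mul_zero]
    · exact mul_div_cancel₀ _ (pow_ne_zero 2 (norm_ne_zero_iff.2 h0))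
  simp_rw [hpt, Finset.sum_sub_distrib]
  rw [Finset.sum_comm (f := fun i _ => inner ℝ (h i) (t i)),
    Finset.sum_comm (f := fun i j => inner ℝ (h i) (t j))]
  simp_rw [hl, ← sum_inner, hh, inner_zero_left, Finset.sum_const_zero, sub_zero]

/-- The motion being centred, a multiple `r` of the total weight is a weighted sum of the
differences between `r` and the relative stretchings. -/
lemma abs_mul_sum_sq_norm_sub_le (hcentred : ∑ k, ∑ l, ‖t k - t l‖ ^ 2 * stretching t h k l = 0)
    (r : ℝ) (i : ι) :
    |r| * ∑ k, ∑ l, ‖t k - t l‖ ^ 2 ≤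
      2 * ∑ k, ∑ l, ‖t i - t k‖ * ‖t k - t l‖ * |r - stretching t h k l| := by
  have hweighted : r * ∑ k, ∑ l, ‖t k - t l‖ ^ 2 =
      ∑ k, ∑ l, ‖t k - t l‖ ^ 2 * (r - stretching t h k l) := by
    simp_rw [mul_sub, Finset.sum_sub_distrib, hcentred, sub_zero, Finset.mul_sum, mul_comm r]
  have hswap : ∑ k, ∑ l, ‖t i - t l‖ * ‖t k - t l‖ * |r - stretching t h k l| =
      ∑ k, ∑ l, ‖t i - t k‖ * ‖t k - t l‖ * |r - stretching t h k l| := by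
    rw [Finset.sum_comm]
    simp_rw [norm_sub_rev (t _) (t _), stretching_comm t h]
  have htri (k l : ι) : ‖t k - t l‖ ≤ ‖t i - t k‖ + ‖t i - t l‖ := by
    rw [norm_sub_rev (t i) (t k)]
    exact norm_sub_le_norm_sub_add_norm_sub _ _ _
  calc |r| * ∑ k, ∑ l, ‖t k - t l‖ ^ 2
      = |∑ k, ∑ l, ‖t k - t l‖ ^ 2 * (r - stretching t h k l)| := by
        rw [← hweighted, abs_mul, abs_of_nonneg (a := ∑ k, ∑ l, ‖t k - t l‖ ^ 2) (by positivity)]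
    _ ≤ ∑ k, ∑ l, |‖t k - t l‖ ^ 2 * (r - stretching t h k l)| :=
        (Finset.abs_sum_le_sum_abs _ _).trans
          (Finset.sum_le_sum fun k _ => Finset.abs_sum_le_sum_abs _ _)
    _ ≤ ∑ k, ∑ l, (‖t i - t k‖ * ‖t k - t l‖ * |r - stretching t h k l| +
          ‖t i - t l‖ * ‖t k - t l‖ * |r - stretching t h k l|) := by
        gcongr with k _ l _
        rw [abs_mul, abs_of_nonneg (sq_nonneg _), ← add_mul, ← add_mul, sq]
        gcongr
        exact htri k l
    _ = _ := by simp_rw [Finset.sum_add_distrib]; rw [hswap, two_mul]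

open Classical in
lemma card_le_two_mul_card_hasWideAngles {β : ℝ}
    (hnarrow : ∀ i j, i ≠ j →
      6 * Finset.card {m | ¬ HasWideAngles t β i j m} ≤ Fintype.card ι) {i j k l : ι}
    (hij : i ≠ j) (hik : i ≠ k) (hkl : k ≠ l) :
    Fintype.card ι ≤ 2 * Finset.card {m | HasWideAngles t β i j m ∧ HasWideAngles t β i k m ∧
      HasWideAngles t β k l m} := by
  have hcover : (Finset.univ : Finset ι) ⊆
      ({m | HasWideAngles t β i j m ∧ HasWideAngles t β i k m ∧ HasWideAngles t β k l m} :
        Finset ι) ∪ ({m | ¬ HasWideAngles t β i j m} : Finset ι) ∪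
      ({m | ¬ HasWideAngles t β i k m} : Finset ι) ∪
      ({m | ¬ HasWideAngles t β k l m} : Finset ι) := by
    intro m _
    simp only [Finset.mem_union, Finset.mem_filter_univ]
    tauto
  have hcard := (Finset.card_le_card hcover).trans
    ((Finset.card_union_le _ _).trans (Nat.add_le_add_right ((Finset.card_union_le _ _).trans
      (Nat.add_le_add_right (Finset.card_union_le _ _) _)) _))
  rw [Finset.card_univ] at hcard
  have hij := hnarrow i j hij
  have hik := hnarrow i k hik
  have hkl := hnarrow k l hkl
  omega

open Classical in
lemma card_mul_abs_stretching_sub_le_sum_chainBound {β : ℝ} (hβ : 0 ≤ β)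
    (hnarrow : ∀ i j, i ≠ j →
      6 * Finset.card {m | ¬ HasWideAngles t β i j m} ≤ Fintype.card ι) (i j k l : ι) :
    Fintype.card ι * (β * (‖t i - t j‖ * ‖t i - t k‖ * ‖t k - t l‖ *
        |stretching t h i j - stretching t h k l|)) ≤ 2 * ∑ m, chainBound t h i j k l m := by
  have hsum_nonneg : 0 ≤ ∑ m, chainBound t h i j k l m :=
    Finset.sum_nonneg fun m _ => chainBound_nonneg h i j k l m
  by_cases hdeg : i = j ∨ i = k ∨ k = l
  · have : ‖t i - t j‖ * ‖t i - t k‖ * ‖t k - t l‖ = 0 := by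
      rcases hdeg with rfl | rfl | rfl <;> simp
    rw [this, zero_mul, mul_zero, mul_zero]
    positivity
  push Not at hdeg
  set wide : Finset ι := {m | HasWideAngles t β i j m ∧ HasWideAngles t β i k m ∧
    HasWideAngles t β k l m}
  have hcard : Fintype.card ι ≤ 2 * wide.card :=
    card_le_two_mul_card_hasWideAngles hnarrow hdeg.1 hdeg.2.1 hdeg.2.2
  calc _ ≤ ((2 * wide.card : ℕ) : ℝ) * (β * (‖t i - t j‖ * ‖t i - t k‖ * ‖t k - t l‖ *
        |stretching t h i j - stretching t h k l|)) := by gcongr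
    _ = 2 * ∑ _m ∈ wide, β * (‖t i - t j‖ * ‖t i - t k‖ * ‖t k - t l‖ *
        |stretching t h i j - stretching t h k l|) := by
        rw [Finset.sum_const, nsmul_eq_mul, Nat.cast_mul, Nat.cast_ofNat, mul_assoc]
    _ ≤ 2 * ∑ m ∈ wide, chainBound t h i j k l m := by
        gcongr with m hm
        obtain ⟨hij, hik, hkl⟩ := (Finset.mem_filter.1 hm).2
        exact mul_abs_stretching_sub_le_chainBound h hij hik hkl hβ
    _ ≤ 2 * ∑ m, chainBound t h i j k l m := by
        gcongr
        · exact fun m _ _ => chainBound_nonneg h i j k l m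
        · exact Finset.subset_univ _

lemma sum_triangleSum (f : ι → ι → ℝ) (i j : ι) :
    ∑ m, triangleSum f i j m = Fintype.card ι * f i j + ∑ m, f i m + ∑ m, f j m := by
  simp only [triangleSum, Finset.sum_add_distrib, Finset.sum_const, Finset.card_univ, nsmul_eq_mul]

lemma sum_sum_triangleSum (f : ι → ι → ℝ) (i : ι) :
    ∑ k, ∑ m, triangleSum f i k m =
      2 * (Fintype.card ι * ∑ k, f i k) + ∑ k, ∑ m, f k m := by
  simp only [sum_triangleSum, Finset.sum_add_distrib, Finset.sum_const, Finset.card_univ,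
    nsmul_eq_mul, ← Finset.mul_sum]
  ring

lemma sum_sum_sum_triangleSum (f : ι → ι → ℝ) :
    ∑ k, ∑ l, ∑ m, triangleSum f k l m = 3 * (Fintype.card ι * ∑ k, ∑ l, f k l) := by
  simp only [sum_sum_triangleSum, Finset.sum_add_distrib, Finset.sum_const, Finset.card_univ,
    nsmul_eq_mul, ← Finset.mul_sum]
  ring

/-- The bound for the relative stretching of the pair `ij` that results from averaging the bound
`chainBound` over all chains, where `c` bounds the ratio of the distances and their mean. -/
noncomputable def stretchBound (c : ℝ) (t h : ι → V) (i j : ι) : ℝ :=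
  c * Fintype.card ι *
      (Fintype.card ι * perpPart t h i j + ∑ k, perpPart t h i k + ∑ k, perpPart t h j k) +
    c ^ 2 * (4 * (Fintype.card ι * ∑ k, perpPart t h i k) + 5 * ∑ k, ∑ l, perpPart t h k l)

lemma stretchBound_nonneg {c : ℝ} (hc : 0 ≤ c) (i j : ι) : 0 ≤ stretchBound c t h i j := by
  have hη := perpPart_nonneg t h
  have hrow (i : ι) : 0 ≤ ∑ k, perpPart t h i k := Finset.sum_nonneg fun k _ => hη i k
  have htotal : 0 ≤ ∑ k, ∑ l, perpPart t h k l := Finset.sum_nonneg fun k _ => hrow k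
  have hcard : (0 : ℝ) ≤ Fintype.card ι := Nat.cast_nonneg _
  exact add_nonneg
    (mul_nonneg (mul_nonneg hc hcard)
      (add_nonneg (add_nonneg (mul_nonneg hcard (hη i j)) (hrow i)) (hrow j)))
    (mul_nonneg (sq_nonneg c)
      (add_nonneg (mul_nonneg (by norm_num) (mul_nonneg hcard (hrow i)))
        (mul_nonneg (by norm_num) htotal)))

lemma card_pow_mul_sum_chainBound_le {c : ℝ}
    (hD : ∀ i j, (Fintype.card ι : ℝ) ^ 2 * ‖t i - t j‖ ≤ c * ∑ k, ∑ l, ‖t k - t l‖) (i j : ι) :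
    (Fintype.card ι : ℝ) ^ 4 * ∑ k, ∑ l, ∑ m, chainBound t h i j k l m ≤
      (∑ k, ∑ l, ‖t k - t l‖) ^ 2 * (Fintype.card ι * stretchBound c t h i j) := by
  set n : ℝ := (Fintype.card ι : ℝ)
  set S := ∑ k, ∑ l, ‖t k - t l‖
  set C := c * S with hCS
  calc n ^ 4 * ∑ k, ∑ l, ∑ m, chainBound t h i j k l m
      ≤ ∑ k, ∑ l, ∑ m, (n ^ 2 * C * (‖t k - t l‖ * triangleSum (perpPart t h) i j m) +
        C ^ 2 * (2 * triangleSum (perpPart t h) i k m +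
          triangleSum (perpPart t h) k l m)) := by
        simp_rw [Finset.mul_sum]
        gcongr
        exact pow_four_mul_chainBound_le h hD _ _ _ _ _
    _ = n ^ 2 * C * (S * ∑ m, triangleSum (perpPart t h) i j m) +
        C ^ 2 * (2 * (n * ∑ k, ∑ m, triangleSum (perpPart t h) i k m) +
          ∑ k, ∑ l, ∑ m, triangleSum (perpPart t h) k l m) := by
        simp_rw [Finset.sum_add_distrib, ← Finset.mul_sum, ← Finset.sum_mul, Finset.sum_add_distrib,
          ← Finset.mul_sum, Finset.sum_const, Finset.card_univ, nsmul_eq_mul, ← Finset.mul_sum]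
        rfl
    _ = _ := by
        rw [sum_triangleSum, sum_sum_triangleSum, sum_sum_sum_triangleSum, stretchBound,
          hCS]
        ring

open Classical in
lemma card_mul_abs_stretching_mul_sum_le {β : ℝ} (hβ : 0 ≤ β)
    (hnarrow : ∀ i j, i ≠ j →
      6 * Finset.card {m | ¬ HasWideAngles t β i j m} ≤ Fintype.card ι)
    (hcentred : ∑ k, ∑ l, ‖t k - t l‖ ^ 2 * stretching t h k l = 0) (i j : ι) :
    Fintype.card ι * (β * (‖t i - t j‖ * |stretching t h i j|)) * ∑ k, ∑ l, ‖t k - t l‖ ^ 2 ≤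
      4 * ∑ k, ∑ l, ∑ m, chainBound t h i j k l m := by
  calc _ = Fintype.card ι * (β * ‖t i - t j‖) *
        (|stretching t h i j| * ∑ k, ∑ l, ‖t k - t l‖ ^ 2) := by ring
    _ ≤ Fintype.card ι * (β * ‖t i - t j‖) * (2 * ∑ k, ∑ l, ‖t i - t k‖ * ‖t k - t l‖ *
          |stretching t h i j - stretching t h k l|) := by
        gcongr _ * ?_
        exact abs_mul_sum_sq_norm_sub_le hcentred _ i
    _ = 2 * ∑ k, ∑ l, Fintype.card ι * (β * (‖t i - t j‖ * ‖t i - t k‖ * ‖t k - t l‖ *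
          |stretching t h i j - stretching t h k l|)) := by
        simp_rw [← Finset.mul_sum, mul_assoc ‖t i - t j‖, ← Finset.mul_sum]
        ring
    _ ≤ 2 * ∑ k, ∑ l, 2 * ∑ m, chainBound t h i j k l m := by
        gcongr 2 * ∑ _, ∑ _, ?_ with k _ l _
        exact card_mul_abs_stretching_sub_le_sum_chainBound hβ hnarrow i j k l
    _ = 4 * ∑ k, ∑ l, ∑ m, chainBound t h i j k l m := by
        simp_rw [← Finset.mul_sum]
        ring

open Classical in
/-- The points `t` are in sufficiently general position: every pair has wide angles at all but a
sixth of the other points, and no distance is larger than `c` times the mean over all pairs. -/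
structure IsWellSpread (t : ι → V) (β c : ℝ) : Prop where
  narrow_le : ∀ i j, i ≠ j → 6 * Finset.card {m | ¬ HasWideAngles t β i j m} ≤ Fintype.card ι
  dist_le : ∀ i j, (Fintype.card ι : ℝ) ^ 2 * ‖t i - t j‖ ≤ c * ∑ k, ∑ l, ‖t k - t l‖

lemma IsWellSpread.card_sq_mul_abs_stretching_le {β c : ℝ} (ht : IsWellSpread t β c)
    (hβ : 0 ≤ β) (hc : 0 ≤ c)
    (hcentred : ∑ k, ∑ l, ‖t k - t l‖ ^ 2 * stretching t h k l = 0) (i j : ι) :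
    (Fintype.card ι : ℝ) ^ 2 * (β * (‖t i - t j‖ * |stretching t h i j|)) ≤
      4 * stretchBound c t h i j := by
  have hchain := card_pow_mul_sum_chainBound_le (h := h) ht.dist_le i j
  have hstretch := card_mul_abs_stretching_mul_sum_le hβ ht.narrow_le hcentred i j
  have hDij := ht.dist_le i j
  set n : ℝ := (Fintype.card ι : ℝ)
  set S := ∑ k, ∑ l, ‖t k - t l‖
  have hn0 : 0 < n := Nat.cast_pos.2 (Fintype.card_pos_iff.2 ⟨i⟩)
  have hS0 : 0 ≤ S := by positivity
  rcases hS0.eq_or_lt with hS0 | hS0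
  · have hij : ‖t i - t j‖ = 0 := le_antisymm
      (nonpos_of_mul_nonpos_right (by rwa [← hS0, mul_zero] at hDij) (pow_pos hn0 2))
      (norm_nonneg _)
    rw [hij, zero_mul, mul_zero, mul_zero]
    exact mul_nonneg zero_le_four (stretchBound_nonneg hc i j)
  have hcauchy : S ^ 2 ≤ n ^ 2 * ∑ k, ∑ l, ‖t k - t l‖ ^ 2 := by
    have := sq_sum_le_card_mul_sum_sq (s := (Finset.univ : Finset (ι × ι)))
      (f := fun e => ‖t e.1 - t e.2‖)
    rwa [Fintype.sum_prod_type, Fintype.sum_prod_type, Finset.card_univ, Fintype.card_prod,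
      Nat.cast_mul, ← sq] at this
  refine le_of_mul_le_mul_left ?_ (show 0 < n * S ^ 2 by positivity)
  calc n * S ^ 2 * (n ^ 2 * (β * (‖t i - t j‖ * |stretching t h i j|)))
      ≤ n * (n ^ 2 * ∑ k, ∑ l, ‖t k - t l‖ ^ 2) *
        (n ^ 2 * (β * (‖t i - t j‖ * |stretching t h i j|))) := by gcongr
    _ = n ^ 4 * (n * (β * (‖t i - t j‖ * |stretching t h i j|)) *
        ∑ k, ∑ l, ‖t k - t l‖ ^ 2) := by ring
    _ ≤ n ^ 4 * (4 * ∑ k, ∑ l, ∑ m, chainBound t h i j k l m) := by gcongr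
    _ ≤ n * S ^ 2 * (4 * stretchBound c t h i j) := by linarith

end Averaging

section DartSums

variable {ι : Type*} [Fintype ι] {B G : SimpleGraph ι} {f g : ι → ι → ℝ}

open Classical in
/-- The sum of `f` over the darts of `G`, that is, over its edges in both orientations. -/
noncomputable def dartSum (G : SimpleGraph ι) (f : ι → ι → ℝ) : ℝ := ∑ i, ∑ j with G.Adj i j, f i j

lemma dartSum_mono (hfg : ∀ i j, G.Adj i j → f i j ≤ g i j) : dartSum G f ≤ dartSum G g := by
  classical
  unfold dartSum
  gcongr with i _ j hij
  exact hfg i j (Finset.mem_filter.1 hij).2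

lemma dartSum_nonneg (hf : ∀ i j, 0 ≤ f i j) : 0 ≤ dartSum G f :=
  Finset.sum_nonneg fun i _ => Finset.sum_nonneg fun j _ => hf i j

lemma dartSum_add : dartSum G (fun i j => f i j + g i j) = dartSum G f + dartSum G g := by
  simp only [dartSum, Finset.sum_add_distrib]

lemma dartSum_const_mul (r : ℝ) : dartSum G (fun i j => r * f i j) = r * dartSum G f := by
  simp only [dartSum, Finset.mul_sum]

lemma dartSum_swap (G : SimpleGraph ι) (f : ι → ι → ℝ) :
    dartSum G (fun i j => f j i) = dartSum G f := by
  classical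
  unfold dartSum
  rw [Finset.sum_comm' (t' := Finset.univ) (s' := fun j => Finset.univ.filter (G.Adj j))]
  simp only [Finset.mem_univ, Finset.mem_filter, true_and, and_true, G.adj_comm, implies_true]

lemma dartSum_top (hf : ∀ i, f i i = 0) :
    dartSum (⊤ : SimpleGraph ι) f = ∑ i, ∑ j, f i j := by
  refine Finset.sum_congr rfl fun i _ => ?_
  rw [Finset.sum_filter]
  refine Finset.sum_congr rfl fun j _ => ?_
  rcases eq_or_ne i j with rfl | hij
  · rw [hf, ite_self]
  · exact if_pos hij

lemma dartSum_fst_le {d : ℝ} (hd : ∀ i, ((B.neighborSet i).ncard : ℝ) ≤ d) {a : ι → ℝ}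
    (ha : ∀ i, 0 ≤ a i) : dartSum B (fun i _ => a i) ≤ d * ∑ i, a i := by
  classical
  unfold dartSum
  rw [Finset.mul_sum]
  gcongr with i
  rw [Finset.sum_const, nsmul_eq_mul, ← Set.ncard_coe_finset, Finset.coe_filter_univ]
  exact mul_le_mul_of_nonneg_right (hd i) (ha i)

open Classical in
/-- By double counting: every dart of `G` is the first step of at most `d` paths of length two in
`G` that join the ends of a dart of `B`. -/
lemma mul_dartSum_le_of_paths {a d : ℝ} (hf₀ : ∀ i j, 0 ≤ f i j)
    (hpath : ∀ i j, B.Adj i j → a * f i j ≤ ∑ k with G.Adj i k ∧ G.Adj j k, (f i k + f j k))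
    (hd : ∀ i k, ((B.neighborSet i ∩ G.neighborSet k).ncard : ℝ) ≤ d) :
    a * dartSum B f ≤ 2 * d * dartSum G f := by
  have hswap : dartSum B (fun i j => ∑ k with G.Adj i k ∧ G.Adj j k, f i k) =
      dartSum G (fun i k => ∑ j with B.Adj i j ∧ G.Adj k j, f i k) := by
    refine Finset.sum_congr rfl fun i _ => Finset.sum_comm' fun j k => ?_
    simp only [Finset.mem_filter_univ, G.adj_comm k j]
    tauto
  have hright : dartSum B (fun i j => ∑ k with G.Adj i k ∧ G.Adj j k, f j k) =
      dartSum B (fun i j => ∑ k with G.Adj i k ∧ G.Adj j k, f i k) := by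
    rw [← dartSum_swap]
    simp only [and_comm]
  calc a * dartSum B f
      ≤ dartSum B (fun i j => ∑ k with G.Adj i k ∧ G.Adj j k, (f i k + f j k)) := by
        rw [← dartSum_const_mul]
        exact dartSum_mono hpath
    _ = 2 * dartSum G (fun i k => ∑ j with B.Adj i j ∧ G.Adj k j, f i k) := by
        simp only [Finset.sum_add_distrib]
        rw [dartSum_add, hright, hswap, two_mul]
    _ ≤ 2 * dartSum G (fun i k => d * f i k) := by
        refine mul_le_mul_of_nonneg_left (dartSum_mono fun i k _ => ?_) zero_le_two
        rw [Finset.sum_const, nsmul_eq_mul, ← Set.ncard_coe_finset, Finset.coe_filter_univ]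
        exact mul_le_mul_of_nonneg_right (hd i k) (hf₀ i k)
    _ = 2 * d * dartSum G f := by rw [dartSum_const_mul, mul_assoc]

end DartSums

section GraphOf

variable {n : ℕ} {A : Finset (Fin n × Fin n)}

lemma graphOf_adj (hA : ∀ i j, (i, j) ∈ A → (j, i) ∉ A) {i j : Fin n} :
    (graphOf A).Adj i j ↔ (i, j) ∈ A ∨ (j, i) ∈ A := by
  rw [graphOf, SimpleGraph.fromRel_adj, and_iff_right_iff_imp]
  rintro h rfl
  exact hA i i (or_self_iff.1 h) (or_self_iff.1 h)

lemma dartSum_graphOf (hA : ∀ i j, (i, j) ∈ A → (j, i) ∉ A) {f : Fin n → Fin n → ℝ}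
    (hf : ∀ i j, f i j = f j i) : dartSum (graphOf A) f = 2 * ∑ e ∈ A, f e.1 e.2 := by
  classical
  have hpt (i j : Fin n) : (if (graphOf A).Adj i j then f i j else 0) =
      (if (i, j) ∈ A then f i j else 0) + (if (j, i) ∈ A then f j i else 0) := by
    rw [graphOf_adj hA]
    by_cases hij : (i, j) ∈ A
    · rw [if_pos (.inl hij), if_pos hij, if_neg (hA i j hij), add_zero]
    · simp only [hij, false_or, if_false, zero_add, hf i j]
  have hsum : ∑ i, ∑ j, (if (i, j) ∈ A then f i j else 0) = ∑ e ∈ A, f e.1 e.2 := by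
    rw [← Fintype.sum_prod_type' (f := fun i j => if (i, j) ∈ A then f i j else 0),
      Finset.sum_ite_mem, Finset.univ_inter]
  simp_rw [dartSum, Finset.sum_filter, hpt, Finset.sum_add_distrib]
  rw [Finset.sum_comm (f := fun i j => if (j, i) ∈ A then f j i else 0), hsum, two_mul]

lemma sum_norm_sub_eq_meanDist (t : Fin n → E3) :
    ∑ i, ∑ j, ‖t i - t j‖ = n * (n - 1) * meanDist t := by
  rcases le_or_gt n 1 with hn | hn
  · interval_cases n <;> simp
  classical
  set A : Finset (Fin n × Fin n) := {e | e.1 < e.2} with hA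
  have hlt (i j : Fin n) : (i, j) ∈ A ↔ i < j := Finset.mem_filter_univ _
  have hAanti (i j : Fin n) (h : (i, j) ∈ A) : (j, i) ∉ A := by
    rw [hlt] at h ⊢
    exact h.not_gt
  have htop : graphOf A = ⊤ := by
    ext i j
    rw [graphOf_adj hAanti, hlt, hlt, SimpleGraph.top_adj, ne_iff_lt_or_gt]
  rw [← dartSum_top (fun i => by rw [sub_self, norm_zero]), ← htop,
    dartSum_graphOf hAanti fun i j => norm_sub_rev _ _, meanDist, ← hA, Nat.cast_choose_two]
  have : (1 : ℝ) < n := Nat.one_lt_cast.2 hn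
  have : (n : ℝ) - 1 ≠ 0 := by linarith
  field_simp

end GraphOf

section Rigidity

variable {V ι : Type*} [NormedAddCommGroup V] [InnerProductSpace ℝ V] [Fintype ι] {t h : ι → V}
  {β c : ℝ}

lemma IsWellSpread.eq_zero_of_perpPart_eq_zero (ht : IsWellSpread t β c) (hβ : 0 < β)
    (hc : 0 ≤ c) (hh : ∑ i, h i = 0) (hl : ∑ i, inner ℝ (h i) (t i) = 0)
    (hη : ∀ i j, perpPart t h i j = 0) : h = 0 := by
  have hconst (i j : ι) : h i = h j := by
    have hcard : (0 : ℝ) < Fintype.card ι := Nat.cast_pos.2 (Fintype.card_pos_iff.2 ⟨i⟩)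
    have hstretch := ht.card_sq_mul_abs_stretching_le hβ.le hc (sum_sq_mul_stretching hh hl) i j
    simp only [stretchBound, hη, Finset.sum_const_zero, mul_zero, add_zero, ← mul_assoc] at hstretch
    have hnorm := norm_sub_le_perpPart_add t h i j
    rw [hη, zero_add] at hnorm
    refine sub_eq_zero.1 (norm_le_zero_iff.1 (hnorm.trans ?_))
    rw [mul_assoc] at hstretch
    exact nonpos_of_mul_nonpos_right hstretch (by positivity)
  ext i
  have : Nonempty ι := ⟨i⟩
  have hsum : (Fintype.card ι : ℝ) • h i = 0 := by
    rw [Nat.cast_smul_eq_nsmul, ← Finset.card_univ, ← Finset.sum_const, ← hh]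
    exact Finset.sum_congr rfl fun j _ => hconst i j
  exact (smul_eq_zero.1 hsum).resolve_left (Nat.cast_ne_zero.2 Fintype.card_ne_zero)

variable {B : SimpleGraph ι} {d : ℝ}

lemma dartSum_stretchBound_le (hc : 1 ≤ c)
    (hd : ∀ i, ((B.neighborSet i).ncard : ℝ) ≤ d * Fintype.card ι) :
    dartSum B (stretchBound c t h) ≤ (Fintype.card ι : ℝ) ^ 2 *
      (c * dartSum B (perpPart t h) + 11 * (c ^ 2 * d * ∑ i, ∑ j, perpPart t h i j)) := by
  set n : ℝ := (Fintype.card ι : ℝ)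
  set H := ∑ i, ∑ j, perpPart t h i j
  set rowSum := dartSum B fun i _ => ∑ k, perpPart t h i k
  have hrow (i : ι) : 0 ≤ ∑ k, perpPart t h i k :=
    Finset.sum_nonneg fun k _ => perpPart_nonneg t h i k
  have hrowSum : rowSum ≤ d * n * H := dartSum_fst_le hd hrow
  have hrowSum_nonneg : 0 ≤ rowSum := dartSum_nonneg fun i _ => hrow i
  have htotal : dartSum B (fun _ _ => H) ≤ d * n * (n * H) := by
    have := dartSum_fst_le hd (a := fun _ => H) fun _ => Finset.sum_nonneg fun i _ => hrow i
    rwa [Finset.sum_const, Finset.card_univ, nsmul_eq_mul] at this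
  calc dartSum B (stretchBound c t h)
      = c * n * (n * dartSum B (perpPart t h) + rowSum + rowSum) +
          c ^ 2 * (4 * (n * rowSum) + 5 * dartSum B (fun _ _ => H)) := by
        unfold stretchBound
        rw [dartSum_add, dartSum_const_mul, dartSum_const_mul, dartSum_add, dartSum_add,
          dartSum_add, dartSum_const_mul, dartSum_const_mul, dartSum_const_mul, dartSum_const_mul,
          dartSum_swap B fun i _ => ∑ k, perpPart t h i k]
    _ = c * n ^ 2 * dartSum B (perpPart t h) + (2 * c + 4 * c ^ 2) * n * rowSum +
          5 * c ^ 2 * dartSum B (fun _ _ => H) := by ring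
    _ ≤ c * n ^ 2 * dartSum B (perpPart t h) + (2 * c ^ 2 + 4 * c ^ 2) * n * (d * n * H) +
          5 * c ^ 2 * (d * n * (n * H)) := by
        gcongr
        exact le_self_pow₀ hc two_ne_zero
    _ = _ := by ring

lemma IsWellSpread.mul_dartSum_stretching_le (ht : IsWellSpread t β c) (hβ : 0 ≤ β) (hc : 1 ≤ c)
    (hcentred : ∑ i, ∑ j, ‖t i - t j‖ ^ 2 * stretching t h i j = 0)
    (hd : ∀ i, ((B.neighborSet i).ncard : ℝ) ≤ d * Fintype.card ι) :
    β * dartSum B (fun i j => ‖t i - t j‖ * |stretching t h i j|) ≤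
      4 * c * dartSum B (perpPart t h) + 44 * c ^ 2 * d * ∑ i, ∑ j, perpPart t h i j := by
  rcases isEmpty_or_nonempty ι with hι | hι
  · simp only [dartSum, Finset.univ_eq_empty, Finset.sum_empty, mul_zero, add_zero, le_refl]
  have hcard : (0 : ℝ) < Fintype.card ι := Nat.cast_pos.2 Fintype.card_pos
  refine le_of_mul_le_mul_left ?_ (pow_pos hcard 2)
  calc (Fintype.card ι : ℝ) ^ 2 *
        (β * dartSum B (fun i j => ‖t i - t j‖ * |stretching t h i j|))
      ≤ dartSum B (fun i j => 4 * stretchBound c t h i j) := by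
        rw [← dartSum_const_mul, ← dartSum_const_mul]
        exact dartSum_mono fun i j _ =>
          ht.card_sq_mul_abs_stretching_le hβ (zero_le_one.trans hc) hcentred i j
    _ ≤ _ := by
        rw [dartSum_const_mul]
        linarith [dartSum_stretchBound_le (t := t) (h := h) hc hd]

end Rigidity

section WellDistributed

variable {n : ℕ} {t : Fin n → E3} {c₁ : ℝ} {B G : SimpleGraph (Fin n)}

open Classical in
lemma ncard_mul_perpPart_le (ht : Function.Injective t) (hG : IsWellDistributedAlong c₁ t G)
    (h : Fin n → E3) {i j : Fin n} (hij : i ≠ j) :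
    ((G.commonNeighbors i j).ncard : ℝ) * (c₁ * perpPart t h i j) ≤
      ∑ k with G.Adj i k ∧ G.Adj j k, (perpPart t h i k + perpPart t h j k) := by
  set A : Finset (Fin n) := {k | G.Adj i k ∧ G.Adj j k} with hA
  have hcard : (G.commonNeighbors i j).ncard = A.card := by
    rw [← Set.ncard_coe_finset, hA, Finset.coe_filter_univ]
    rfl
  have hproj (k : Fin n) :
      ‖((Submodule.span ℝ {t k - t i, t k - t j})ᗮ).starProjection (h i - h j)‖ ≤
        perpPart t h i k + perpPart t h j k := by
    set U : Submodule ℝ E3 := Submodule.span ℝ {t k - t i, t k - t j}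
    have hi : t i - t k ∈ U := by
      rw [← neg_sub]
      exact U.neg_mem (Submodule.subset_span (Set.mem_insert _ _))
    have hj : t j - t k ∈ U := by
      rw [← neg_sub]
      exact U.neg_mem (Submodule.subset_span (Set.mem_insert_of_mem _ rfl))
    rw [← sub_sub_sub_cancel_right (h i) (h j) (h k), map_sub]
    exact (norm_sub_le _ _).trans (add_le_add
      (norm_starProjection_orthogonal_le_norm_rejection hi _)
      (norm_starProjection_orthogonal_le_norm_rejection hj _))
  have hwd : c₁ * perpPart t h i j ≤ 1 / (A.card : ℝ) *
      ∑ k ∈ A, ‖((Submodule.span ℝ {t k - t i, t k - t j})ᗮ).starProjection (h i - h j)‖ := by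
    have := hG i j hij (h i - h j)
    rwa [Finset.card_image_of_injective A ht, Finset.sum_image ht.injOn] at this
  rw [hcard]
  refine le_trans ?_ (Finset.sum_le_sum fun k _ => hproj k)
  rcases A.card.eq_zero_or_pos with h0 | h0
  · rw [h0, Nat.cast_zero, zero_mul]
    exact Finset.sum_nonneg fun k _ => norm_nonneg _
  · rwa [mul_comm, ← le_div_iff₀ (Nat.cast_pos.2 h0), div_eq_inv_mul, ← one_div]

lemma mul_dartSum_perpPart_le {M d : ℝ} (ht : Function.Injective t)
    (hG : IsWellDistributedAlong c₁ t G) (hc₁ : 0 ≤ c₁) (h : Fin n → E3)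
    (hM : ∀ i j, i ≠ j → M ≤ ((G.commonNeighbors i j).ncard : ℝ))
    (hd : ∀ i k, ((B.neighborSet i ∩ G.neighborSet k).ncard : ℝ) ≤ d) :
    M * c₁ * dartSum B (perpPart t h) ≤ 2 * d * dartSum G (perpPart t h) := by
  refine mul_dartSum_le_of_paths (perpPart_nonneg t h) (fun i j hij => ?_) hd
  rw [mul_assoc]
  exact (mul_le_mul_of_nonneg_right (hM i j hij.ne)
    (mul_nonneg hc₁ (perpPart_nonneg t h i j))).trans (ncard_mul_perpPart_le ht hG h hij.ne)

end WellDistributed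

section Direction

lemma norm_direction {x y : E3} (h : x ≠ y) : ‖direction x y‖ = 1 :=
  norm_smul_inv_norm (𝕜 := ℝ) (sub_ne_zero.2 h)

lemma direction_swap (x y : E3) : direction y x = -direction x y := by
  rw [direction, direction, norm_sub_rev, ← smul_neg, neg_sub]

lemma norm_smul_direction (x y : E3) : ‖x - y‖ • direction x y = x - y := by
  rcases eq_or_ne (x - y) 0 with h | h
  · rw [direction, h, smul_zero, smul_zero]
  · exact smul_inv_smul₀ (norm_ne_zero_iff.2 h) _

lemma rejection_direction (x y v : E3) : rejection (direction x y) v = rejection (x - y) v := by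
  rcases eq_or_ne (x - y) 0 with h | h
  · rw [direction, h, smul_zero]
  · exact rejection_smul_left (inv_ne_zero (norm_ne_zero_iff.2 h)) _ _

lemma mul_norm_sub_le_norm_rejection {β : ℝ} {x y z w : E3} (hzw : z ≠ w)
    (hβ : β ^ 2 ≤ 1 - inner ℝ (direction x y) (direction z w) ^ 2) :
    β * ‖x - y‖ ≤ ‖rejection (z - w) (x - y)‖ := by
  have hinner : inner ℝ (direction z w) (x - y) =
      ‖x - y‖ * inner ℝ (direction x y) (direction z w) := by
    rw [real_inner_comm, ← real_inner_smul_left, norm_smul_direction]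
  refine (le_abs_self _).trans (abs_le_of_sq_le_sq ?_ (norm_nonneg _))
  rw [← rejection_direction, norm_sq_rejection (norm_direction hzw), hinner, mul_pow, mul_pow]
  linarith [mul_le_mul_of_nonneg_right hβ (sq_nonneg ‖x - y‖)]

end Direction

namespace CameraNetwork

variable {n : ℕ} (N : CameraNetwork n)

lemma γstar_swap (i j : Fin n) : N.γstar j i = -N.γstar i j := direction_swap _ _

/-- The requirement of the good-shape condition on the angles of the triangle `ijk`. As it bounds
cosines on one side only, it depends on the order of `i` and `j`. -/
def LargeAngles (β : ℝ) (i j k : Fin n) : Prop :=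
  k ≠ i ∧ k ≠ j ∧ β ^ 2 ≤ 1 - inner ℝ (N.γstar i j) (N.γstar i k) ∧
    β ^ 2 ≤ 1 - inner ℝ (N.γstar i j) (N.γstar j k)

variable {N}

lemma LargeAngles.hasWideAngles {β : ℝ} {i j k : Fin n} (hij : N.LargeAngles β i j k)
    (hji : N.LargeAngles β j i k) : HasWideAngles N.loc β i j k := by
  obtain ⟨hki, hkj, hi, hj⟩ := hij
  obtain ⟨-, -, hj', hi'⟩ := hji
  rw [N.γstar_swap i j, inner_neg_left, sub_neg_eq_add] at hi' hj'
  have hsin {u : ℝ} (h₁ : β ^ 2 ≤ 1 - u) (h₂ : β ^ 2 ≤ 1 + u) : β ^ 2 ≤ 1 - u ^ 2 := by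
    rcases le_total 0 u with hu | hu <;> nlinarith [sq_nonneg β, hu]
  exact ⟨mul_norm_sub_le_norm_rejection (N.loc_injective.ne hki.symm) (hsin hi hi'),
    mul_norm_sub_le_norm_rejection (N.loc_injective.ne hkj.symm) (hsin hj hj')⟩

variable (N)

lemma Egl_subset (c : ℝ) : N.Egl c ⊆ N.E :=
  (Finset.filter_subset _ _).trans Finset.subset_union_left

lemma EglCompl_subset (c : ℝ) : N.EglCompl c ⊆ N.E := Finset.sdiff_subset

lemma sum_EglCompl_add_sum_Egl (c : ℝ) (f : Fin n × Fin n → ℝ) :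
    ∑ e ∈ N.EglCompl c, f e + ∑ e ∈ N.Egl c, f e = ∑ e ∈ N.E, f e :=
  Finset.sum_sdiff (N.Egl_subset c)

lemma not_swap_mem_EglCompl (c : ℝ) (i j : Fin n) (h : (i, j) ∈ N.EglCompl c) :
    (j, i) ∉ N.EglCompl c :=
  fun h' => N.no_repetition i j (N.EglCompl_subset c h) (N.EglCompl_subset c h')

lemma two_mul_sum_EglCompl_norm_sub_le (c : ℝ) (h : Fin n → E3) :
    2 * ∑ e ∈ N.EglCompl c, ‖h e.1 - h e.2‖ ≤
      dartSum (graphOf (N.EglCompl c)) (perpPart N.loc h) +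
        dartSum (graphOf (N.EglCompl c))
          (fun i j => ‖N.loc i - N.loc j‖ * |stretching N.loc h i j|) := by
  rw [← dartSum_graphOf (N.not_swap_mem_EglCompl c) (f := fun i j => ‖h i - h j‖)
    (fun i j => norm_sub_rev _ _), ← dartSum_add]
  exact dartSum_mono fun i j _ => norm_sub_le_perpPart_add N.loc h i j

lemma two_mul_sum_Egl_norm_projPerp (c : ℝ) (h : Fin n → E3) :
    2 * ∑ e ∈ N.Egl c, ‖projPerp (N.γstar e.1 e.2) (h e.1 - h e.2)‖ =
      dartSum (graphOf N.E) (perpPart N.loc h) -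
        dartSum (graphOf (N.EglCompl c)) (perpPart N.loc h) := by
  have hE := dartSum_graphOf (A := N.E) N.no_repetition (perpPart_comm N.loc h)
  rw [hE, dartSum_graphOf (N.not_swap_mem_EglCompl c) (perpPart_comm _ _),
    ← N.sum_EglCompl_add_sum_Egl c, mul_add, add_sub_cancel_left]
  exact congrArg (2 * ·) (Finset.sum_congr rfl fun e _ =>
    congrArg norm (rejection_direction (N.loc e.1) (N.loc e.2) (h e.1 - h e.2)))

/-- Good-long dominance, with strict inequality for every nonzero perturbation. -/
def StrictDominance (c : ℝ) : Prop :=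
  ∀ ε : Fin n → E3, ∑ i, ε i = 0 → ∑ i, inner ℝ (ε i) (N.loc i) = 0 → ε ≠ 0 →
    ∑ e ∈ N.EglCompl c, ‖ε e.1 - ε e.2‖ <
      ∑ e ∈ N.Egl c, ‖projPerp (N.γstar e.1 e.2) (ε e.1 - ε e.2)‖

variable {N}

lemma StrictDominance.goodLongDominance {c : ℝ} (h : N.StrictDominance c) :
    N.GoodLongDominance c := by
  intro ε hε hεl
  rcases eq_or_ne ε 0 with rfl | hne
  · simp only [Pi.zero_apply, sub_self, norm_zero, Finset.sum_const_zero]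
    exact Finset.sum_nonneg fun _ _ => norm_nonneg _
  · exact (h ε hε hεl hne).le

end CameraNetwork

/-- The part of the good-shape condition that forces strict dominance; of the typicality of the
graph it keeps the upper bound for the degrees and the lower bound for the codegrees. -/
structure WeakGoodShape {n : ℕ} (N : CameraNetwork n) (c p β ε₀ ε₁ c₀ c₁ : ℝ) : Prop where
  degree_le : ∀ i, (((graphOf N.E).neighborSet i).ncard : ℝ) ≤ 2 * n * p
  le_codegree : ∀ i j, i ≠ j →
    (1 / 2) * n * p ^ 2 ≤ (((graphOf N.E).commonNeighbors i j).ncard : ℝ)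
  large_angles : ∀ i j, i ≠ j →
    (n : ℝ) - ε₁ * n ≤ (({k | N.LargeAngles β i j k} : Set (Fin n)).ncard : ℝ)
  dist_le : ∀ i j, i ≠ j → ‖N.loc i - N.loc j‖ ≤ c₀ * meanDist N.loc
  max_degree : ∀ i, (((graphOf (N.EglCompl c)).neighborSet i).ncard : ℝ) ≤ ε₀ * n
  well_distributed : IsWellDistributedAlong c₁ N.loc (graphOf N.E)
  well_distributed_complete : IsWellDistributedAlong c₁ N.loc (⊤ : SimpleGraph (Fin n))

section GoodShape

variable {n : ℕ} {N : CameraNetwork n} {c p β ε₀ ε₁ c₀ c₁ : ℝ}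

lemma GoodShape.weakGoodShape (hshape : GoodShape N c p β ε₀ ε₁ c₀ c₁) :
    WeakGoodShape N c p β ε₀ ε₁ c₀ c₁ where
  degree_le i := (hshape.typical.degree i).2
  le_codegree i j hij := (hshape.typical.codegree i j hij).1
  large_angles := hshape.large_angles
  dist_le := hshape.dist_le
  max_degree := hshape.max_degree
  well_distributed := hshape.well_distributed
  well_distributed_complete := hshape.well_distributed_complete

namespace WeakGoodShape

open Classical in
lemma card_not_hasWideAngles_le (hshape : WeakGoodShape N c p β ε₀ ε₁ c₀ c₁) {i j : Fin n}
    (hij : i ≠ j) :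
    (Finset.card {k | ¬ HasWideAngles N.loc β i j k} : ℝ) ≤ 2 * ε₁ * n := by
  have hcount {i j : Fin n} (hij : i ≠ j) :
      (Finset.card {k | ¬ N.LargeAngles β i j k} : ℝ) ≤ ε₁ * n := by
    have hlarge := hshape.large_angles i j hij
    have hsplit := Finset.card_filter_add_card_filter_not (s := Finset.univ) (N.LargeAngles β i j)
    rw [Finset.card_univ, Fintype.card_fin, ← @Nat.cast_inj ℝ, Nat.cast_add] at hsplit
    rw [← Finset.coe_filter_univ, Set.ncard_coe_finset] at hlarge
    linarith
  have hcover : ({k | ¬ HasWideAngles N.loc β i j k} : Finset (Fin n)) ⊆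
      ({k | ¬ N.LargeAngles β i j k} : Finset (Fin n)) ∪
        ({k | ¬ N.LargeAngles β j i k} : Finset (Fin n)) := by
    intro k
    simp only [Finset.mem_union, Finset.mem_filter_univ, ← not_and_or, not_imp_not]
    exact fun h => h.1.hasWideAngles h.2
  have hcard := (Finset.card_le_card hcover).trans (Finset.card_union_le _ _)
  rw [← @Nat.cast_le ℝ, Nat.cast_add] at hcard
  linarith [hcount hij, hcount hij.symm]

lemma four_le (hshape : WeakGoodShape N c p β ε₀ ε₁ c₀ c₁) (hε₁ : ε₁ ≤ 1 / 12) {i j : Fin n}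
    (hij : i ≠ j) : 4 ≤ n := by
  have hsubset : ({k | N.LargeAngles β i j k} : Set (Fin n)) ⊆ ({i, j} : Set (Fin n))ᶜ := by
    rintro k hk (rfl | rfl)
    exacts [hk.1 rfl, hk.2.1 rfl]
  have hcompl := Set.ncard_add_ncard_compl ({i, j} : Set (Fin n))
  rw [Set.ncard_pair hij, Nat.card_fin] at hcompl
  have hle : (({k | N.LargeAngles β i j k} : Set (Fin n)).ncard : ℝ) + 2 ≤ n := by
    have := Set.ncard_le_ncard hsubset
    exact_mod_cast (by omega : ({k | N.LargeAngles β i j k} : Set (Fin n)).ncard + 2 ≤ n)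
  have hlarge := hshape.large_angles i j hij
  have : (4 : ℝ) ≤ n := by nlinarith [Nat.cast_nonneg (α := ℝ) n]
  exact_mod_cast this

lemma isWellSpread (hshape : WeakGoodShape N c p β ε₀ ε₁ c₀ c₁) (hc₀ : 0 ≤ c₀)
    (hε₁ : ε₁ ≤ 1 / 12) : IsWellSpread N.loc β (2 * c₀) where
  narrow_le i j hij := by
    have hle := hshape.card_not_hasWideAngles_le hij
    rw [Fintype.card_fin, ← @Nat.cast_le ℝ, Nat.cast_mul, Nat.cast_ofNat]
    have := mul_le_mul_of_nonneg_right hε₁ (Nat.cast_nonneg (α := ℝ) n)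
    linarith
  dist_le i j := by
    rcases eq_or_ne i j with rfl | hij
    · rw [sub_self, norm_zero, mul_zero]
      positivity
    have hn : (4 : ℝ) ≤ n := by exact_mod_cast hshape.four_le hε₁ hij
    have hμ : 0 ≤ c₀ * meanDist N.loc := (norm_nonneg _).trans (hshape.dist_le i j hij)
    rw [sum_norm_sub_eq_meanDist, Fintype.card_fin]
    calc (n : ℝ) ^ 2 * ‖N.loc i - N.loc j‖ ≤ n ^ 2 * (c₀ * meanDist N.loc) := by
          gcongr
          exact hshape.dist_le i j hij
      _ ≤ (2 * (n * (n - 1))) * (c₀ * meanDist N.loc) := by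
          gcongr
          nlinarith
      _ = 2 * c₀ * (n * (n - 1) * meanDist N.loc) := by ring

lemma ncard_neighborSet_inter_le (hshape : WeakGoodShape N c p β ε₀ ε₁ c₀ c₁)
    {G : SimpleGraph (Fin n)} (i k : Fin n) :
    (((graphOf (N.EglCompl c)).neighborSet i ∩ G.neighborSet k).ncard : ℝ) ≤ ε₀ * n :=
  (Nat.cast_le.2 (Set.ncard_inter_le_ncard_left _ _)).trans (hshape.max_degree i)

section Comparison

variable (hshape : WeakGoodShape N c p β ε₀ ε₁ c₀ c₁) (hn : 4 ≤ n) (hc₁ : 0 < c₁) (h : Fin n → E3)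
include hshape hn hc₁

lemma four_mul_dartSum_EglCompl_perpPart_le (hp : 0 < p) (hε₀ : ε₀ ≤ c₁ * p ^ 2 / 16) :
    4 * dartSum (graphOf (N.EglCompl c)) (perpPart N.loc h) ≤
      dartSum (graphOf N.E) (perpPart N.loc h) := by
  have hpaths := mul_dartSum_perpPart_le (B := graphOf (N.EglCompl c)) N.loc_injective
    hshape.well_distributed hc₁.le h hshape.le_codegree hshape.ncard_neighborSet_inter_le
  set XB := dartSum (graphOf (N.EglCompl c)) (perpPart N.loc h)
  set GE := dartSum (graphOf N.E) (perpPart N.loc h)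
  have hGE : 0 ≤ GE := dartSum_nonneg (perpPart_nonneg _ _)
  refine le_of_mul_le_mul_left ?_ (show 0 < n * (c₁ * p ^ 2) / 8 by positivity)
  calc n * (c₁ * p ^ 2) / 8 * (4 * XB) = 1 / 2 * n * p ^ 2 * c₁ * XB := by ring
    _ ≤ 2 * (ε₀ * n) * GE := hpaths
    _ ≤ 2 * (c₁ * p ^ 2 / 16 * n) * GE := by gcongr
    _ = n * (c₁ * p ^ 2) / 8 * GE := by ring

lemma mul_sum_perpPart_le_dartSum_E (hp : 0 < p) :
    c₁ * p * ∑ i, ∑ j, perpPart N.loc h i j ≤ 8 * dartSum (graphOf N.E) (perpPart N.loc h) := by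
  have hpaths := mul_dartSum_perpPart_le (B := ⊤) N.loc_injective hshape.well_distributed hc₁.le h
    hshape.le_codegree fun i k =>
      (Nat.cast_le.2 (Set.ncard_inter_le_ncard_right _ _)).trans (hshape.degree_le k)
  rw [dartSum_top (perpPart_self _ _)] at hpaths
  refine le_of_mul_le_mul_left ?_ (show 0 < n * p / 2 by positivity)
  linarith

lemma mul_dartSum_EglCompl_perpPart_le :
    c₁ * dartSum (graphOf (N.EglCompl c)) (perpPart N.loc h) ≤
      4 * ε₀ * ∑ i, ∑ j, perpPart N.loc h i j := by
  classical
  have hcommon (i j : Fin n) (hij : i ≠ j) :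
      (n : ℝ) / 2 ≤ (((⊤ : SimpleGraph (Fin n)).commonNeighbors i j).ncard : ℝ) := by
    rw [← Nat.card_coe_set_eq, Nat.card_eq_fintype_card,
      SimpleGraph.card_commonNeighbors_top hij, Fintype.card_fin, Nat.cast_sub (by omega)]
    have : (4 : ℝ) ≤ n := by exact_mod_cast hn
    push_cast
    linarith
  have hpaths := mul_dartSum_perpPart_le (B := graphOf (N.EglCompl c)) N.loc_injective
    hshape.well_distributed_complete hc₁.le h hcommon hshape.ncard_neighborSet_inter_le
  rw [dartSum_top (perpPart_self _ _)] at hpaths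
  refine le_of_mul_le_mul_left ?_ (show 0 < (n : ℝ) / 2 by positivity)
  linarith

lemma four_mul_dartSum_EglCompl_stretching_le (hp : 0 < p) (hβ : 0 < β) (hc₀ : 1 ≤ c₀)
    (hε₀ : ε₀ ≤ β * c₁ * p / (2 ^ 14 * c₀ ^ 2)) (hε₀' : ε₀ ≤ β * c₁ ^ 2 * p / (2 ^ 11 * c₀))
    (hε₁ : ε₁ ≤ 1 / 12) (hh : ∑ i, h i = 0) (hl : ∑ i, inner ℝ (h i) (N.loc i) = 0) :
    4 * dartSum (graphOf (N.EglCompl c))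
        (fun i j => ‖N.loc i - N.loc j‖ * |stretching N.loc h i j|) ≤
      dartSum (graphOf N.E) (perpPart N.loc h) := by
  have hstretch := (hshape.isWellSpread (by linarith) hε₁).mul_dartSum_stretching_le hβ.le
    (by linarith) (sum_sq_mul_stretching hh hl) (by simpa using hshape.max_degree)
  have hXB := hshape.mul_dartSum_EglCompl_perpPart_le hn hc₁ h
  have hH := hshape.mul_sum_perpPart_le_dartSum_E hn hc₁ h hp
  set XB := dartSum (graphOf (N.EglCompl c)) (perpPart N.loc h)
  set GE := dartSum (graphOf N.E) (perpPart N.loc h)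
  set H := ∑ i, ∑ j, perpPart N.loc h i j
  set XD := dartSum (graphOf (N.EglCompl c))
    (fun i j => ‖N.loc i - N.loc j‖ * |stretching N.loc h i j|)
  have hGE : 0 ≤ GE := dartSum_nonneg (perpPart_nonneg _ _)
  rw [le_div_iff₀ (by positivity)] at hε₀ hε₀'
  have hε₀_nonneg : 0 ≤ ε₀ :=
    nonneg_of_mul_nonneg_left ((Nat.cast_nonneg _).trans (hshape.max_degree ⟨0, by omega⟩))
      (by positivity)
  refine le_of_mul_le_mul_left ?_ (show 0 < c₁ * (c₁ * p) * β by positivity)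
  calc c₁ * (c₁ * p) * β * (4 * XD) = 4 * c₁ * (c₁ * p) * (β * XD) := by ring
    _ ≤ 4 * c₁ * (c₁ * p) * (4 * (2 * c₀) * XB + 44 * (2 * c₀) ^ 2 * ε₀ * H) := by gcongr
    _ = 32 * (c₁ * p) * c₀ * (c₁ * XB) + 704 * c₀ ^ 2 * ε₀ * c₁ * (c₁ * p * H) := by ring
    _ ≤ 32 * (c₁ * p) * c₀ * (4 * ε₀ * H) + 704 * c₀ ^ 2 * ε₀ * c₁ * (8 * GE) := by gcongr
    _ = 128 * c₀ * ε₀ * (c₁ * p * H) + 704 * c₀ ^ 2 * ε₀ * c₁ * (8 * GE) := by ring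
    _ ≤ 128 * c₀ * ε₀ * (8 * GE) + 704 * c₀ ^ 2 * ε₀ * c₁ * (8 * GE) := by gcongr
    _ = (ε₀ * (2 ^ 11 * c₀) / 2 + 704 * 8 / 2 ^ 14 * c₁ * (ε₀ * (2 ^ 14 * c₀ ^ 2))) * GE := by ring
    _ ≤ (β * c₁ ^ 2 * p / 2 + 704 * 8 / 2 ^ 14 * c₁ * (β * c₁ * p)) * GE := by gcongr
    _ ≤ c₁ * (c₁ * p) * β * GE := by
        refine mul_le_mul_of_nonneg_right ?_ hGE
        nlinarith [show 0 ≤ β * c₁ ^ 2 * p by positivity]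

end Comparison

lemma exists_perpPart_pos (hshape : WeakGoodShape N c p β ε₀ ε₁ c₀ c₁) (hβ : 0 < β) (hc₀ : 0 ≤ c₀)
    (hε₁ : ε₁ ≤ 1 / 12) {h : Fin n → E3} (hh : ∑ i, h i = 0)
    (hl : ∑ i, inner ℝ (h i) (N.loc i) = 0) (hne : h ≠ 0) : ∃ i j, 0 < perpPart N.loc h i j := by
  by_contra! hη
  exact hne ((hshape.isWellSpread hc₀ hε₁).eq_zero_of_perpPart_eq_zero hβ (by linarith) hh hl
    fun i j => (hη i j).antisymm (perpPart_nonneg _ _ i j))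

theorem strictDominance (hshape : WeakGoodShape N c p β ε₀ ε₁ c₀ c₁) (hp : 0 < p) (hβ : 0 < β)
    (hc₁ : 0 < c₁) (hc₀ : 1 ≤ c₀) (hε₀ : ε₀ ≤ β * c₁ * p / (2 ^ 14 * c₀ ^ 2))
    (hε₀' : ε₀ ≤ β * c₁ ^ 2 * p / (2 ^ 11 * c₀)) (hε₀'' : ε₀ ≤ c₁ * p ^ 2 / 16)
    (hε₁ : ε₁ ≤ 1 / 12) : N.StrictDominance c := by
  intro h hh hl hne
  obtain ⟨i, j, hη⟩ := hshape.exists_perpPart_pos hβ (by linarith) hε₁ hh hl hne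
  have hij : i ≠ j := by
    rintro rfl
    exact hη.ne' (perpPart_self _ _ i)
  have hn := hshape.four_le hε₁ hij
  have hperp := hshape.four_mul_dartSum_EglCompl_perpPart_le hn hc₁ h hp hε₀''
  have hstretch :=
    hshape.four_mul_dartSum_EglCompl_stretching_le hn hc₁ h hp hβ hc₀ hε₀ hε₀' hε₁ hh hl
  have htotal : 0 < ∑ k, ∑ l, perpPart N.loc h k l :=
    Finset.sum_pos' (fun k _ => Finset.sum_nonneg fun l _ => perpPart_nonneg _ _ k l)
      ⟨i, Finset.mem_univ i, Finset.sum_pos' (fun l _ => perpPart_nonneg _ _ i l)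
        ⟨j, Finset.mem_univ j, hη⟩⟩
  have hE : 0 < dartSum (graphOf N.E) (perpPart N.loc h) := by
    have := hshape.mul_sum_perpPart_le_dartSum_E hn hc₁ h hp
    have := mul_pos (mul_pos hc₁ hp) htotal
    linarith
  have hbad := N.two_mul_sum_EglCompl_norm_sub_le c h
  have hgood := N.two_mul_sum_Egl_norm_projPerp c h
  linarith

end WeakGoodShape

end GoodShape

section EdgeCost

variable {γ : E3}

lemma edgeCost_of_one_lt {x y : E3} (h : 1 < inner ℝ γ (x - y)) :
    edgeCost γ x y = ‖rejection γ (x - y)‖ :=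
  if_pos h

lemma isLeast_edgeCost (hγ : ‖γ‖ = 1) (x y : E3) :
    IsLeast ((fun α : ℝ => ‖x - y - α • γ‖) '' Set.Ici 1) (edgeCost γ x y) := by
  by_cases h : 1 < inner ℝ γ (x - y)
  · rw [edgeCost_of_one_lt h]
    refine ⟨⟨inner ℝ γ (x - y), h.le, ?_⟩, ?_⟩
    · simp only [rejection_apply, hγ, one_pow, div_one]
    · rintro _ ⟨α, -, rfl⟩
      calc ‖rejection γ (x - y)‖ = ‖rejection γ (x - y - α • γ)‖ := by
            rw [map_sub _ (x - y), map_smul, rejection_self, smul_zero, sub_zero]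
        _ ≤ ‖x - y - α • γ‖ := norm_rejection_le _ _
  · rw [edgeCost, if_neg h]
    refine ⟨⟨1, Set.self_mem_Ici, by simp only [one_smul]⟩, ?_⟩
    rintro _ ⟨α, hα : 1 ≤ α, rfl⟩
    have hsq (α : ℝ) : ‖x - y - α • γ‖ ^ 2 =
        ‖x - y‖ ^ 2 - 2 * (α * inner ℝ γ (x - y)) + α ^ 2 := by
      rw [norm_sub_sq_real, real_inner_smul_right, real_inner_comm, norm_smul, hγ, mul_one,
        Real.norm_eq_abs, sq_abs]
    refine (sq_le_sq₀ (norm_nonneg _) (norm_nonneg _)).1 ?_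
    have hone := hsq 1
    rw [one_smul] at hone
    rw [hone, hsq]
    nlinarith [not_lt.1 h]

lemma edgeCost_le_edgeCost_add (hγ : ‖γ‖ = 1) (x y v w : E3) :
    edgeCost γ x y ≤ edgeCost γ (x + v) (y + w) + ‖v - w‖ := by
  obtain ⟨α, hα, hmin⟩ := (isLeast_edgeCost hγ (x + v) (y + w)).1
  calc edgeCost γ x y ≤ ‖x - y - α • γ‖ := (isLeast_edgeCost hγ x y).2 ⟨α, hα, rfl⟩
    _ = ‖(x + v - (y + w) - α • γ) - (v - w)‖ := by congr 1; abel
    _ ≤ edgeCost γ (x + v) (y + w) + ‖v - w‖ := hmin ▸ norm_sub_le _ _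

lemma convexOn_edgeCost (hγ : ‖γ‖ = 1) :
    ConvexOn ℝ Set.univ fun z : E3 × E3 => edgeCost γ z.1 z.2 := by
  refine ⟨convex_univ, fun z _ z' _ a b ha hb hab => ?_⟩
  obtain ⟨α, hα, hmin⟩ := (isLeast_edgeCost hγ z.1 z.2).1
  obtain ⟨α', hα', hmin'⟩ := (isLeast_edgeCost hγ z'.1 z'.2).1
  have hmem : 1 ≤ a • α + b • α' := convex_Ici (𝕜 := ℝ) (1 : ℝ) hα hα' ha hb hab
  refine ((isLeast_edgeCost hγ _ _).2 ⟨a • α + b • α', hmem, rfl⟩).trans ?_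
  calc ‖(a • z + b • z').1 - (a • z + b • z').2 - (a • α + b • α') • γ‖
      = ‖a • (z.1 - z.2 - α • γ) + b • (z'.1 - z'.2 - α' • γ)‖ := by
        congr 1
        simp only [Prod.fst_add, Prod.snd_add, Prod.smul_fst, Prod.smul_snd, smul_eq_mul]
        module
    _ ≤ a • edgeCost γ z.1 z.2 + b • edgeCost γ z'.1 z'.2 := by
        refine (norm_add_le _ _).trans_eq ?_
        simp only [norm_smul, Real.norm_of_nonneg ha, Real.norm_of_nonneg hb, smul_eq_mul, ← hmin,
          ← hmin']

end EdgeCost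

/-- Orthogonal decomposition along the centred family `i ↦ t i - m`, with `m` the centroid. -/
lemma exists_dilation_add {V ι : Type*} [NormedAddCommGroup V] [InnerProductSpace ℝ V] [Fintype ι]
    (t : ι → V) {w : ι → V} (hw : ∑ i, w i = 0) :
    ∃ (a : ℝ) (b : V) (ε : ι → V), (∀ i, w i = a • t i + b + ε i) ∧ ∑ i, ε i = 0 ∧
      ∑ i, inner ℝ (ε i) (t i) = 0 := by
  rcases isEmpty_or_nonempty ι with hι | hι
  · exact ⟨0, 0, w, fun i => by rw [zero_smul, zero_add, zero_add], hw, Fintype.sum_empty _⟩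
  set m : V := (Fintype.card ι : ℝ)⁻¹ • ∑ i, t i with hm
  set y : ι → V := fun i => t i - m
  have hy : ∑ i, y i = 0 := by
    rw [Finset.sum_sub_distrib, Finset.sum_const, Finset.card_univ, ← Nat.cast_smul_eq_nsmul ℝ, hm,
      smul_inv_smul₀ (Nat.cast_ne_zero.2 Fintype.card_ne_zero), sub_self]
  set a : ℝ := inner ℝ (WithLp.toLp 2 y) (WithLp.toLp 2 w) / ‖WithLp.toLp 2 y‖ ^ 2
  have hortho := inner_rejection_left (WithLp.toLp 2 y) (WithLp.toLp 2 w)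
  rw [rejection_apply, PiLp.inner_apply] at hortho
  have hε : ∑ i, (w i - a • y i) = 0 := by
    rw [Finset.sum_sub_distrib, hw, ← Finset.smul_sum, hy, smul_zero, sub_zero]
  refine ⟨a, -(a • m), fun i => w i - a • y i, fun i => ?_, hε, ?_⟩
  · simp only [y]
    module
  · calc ∑ i, inner ℝ (w i - a • y i) (t i)
        = ∑ i, inner ℝ (w i - a • y i) (y i) + inner ℝ (∑ i, (w i - a • y i)) m := by
          simp only [sum_inner, ← Finset.sum_add_distrib, ← inner_add_right, y, sub_add_cancel]
      _ = 0 := by rw [hε, inner_zero_left, add_zero]; exact hortho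

namespace CameraNetwork

variable {n : ℕ} (N : CameraNetwork n)

lemma convexOn_objective : ConvexOn ℝ Set.univ N.objective := by
  refine ⟨convex_univ, fun t _ u _ a b ha hb hab => ?_⟩
  simp only [objective, Finset.smul_sum, ← Finset.sum_add_distrib]
  exact Finset.sum_le_sum fun e he => (convexOn_edgeCost (N.norm_γ e.1 e.2 he)).2
    (Set.mem_univ (t e.1, t e.2)) (Set.mem_univ (u e.1, u e.2)) ha hb hab

/-- The image of the locations under a dilation and a translation, that is, a competitor in the
oracle problem. -/
def dilate (c : ℝ) (s : E3) : Fin n → E3 := fun i => c • N.loc i + s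

lemma dilate_sub (c : ℝ) (s : E3) (i j : Fin n) :
    N.dilate c s i - N.dilate c s j = c • (N.loc i - N.loc j) := by
  rw [dilate, dilate, add_sub_add_right_eq_sub, smul_sub]

lemma dilate_add_smul (c a τ : ℝ) (s b : E3) :
    N.dilate (c + τ * a) (s + τ • b) = N.dilate c s + τ • N.dilate a b := by
  ext1 i
  simp only [dilate, Pi.add_apply, Pi.smul_apply]
  module

/-- The region of the families at which the costs of all the good and long edges are on the branch
where they only see the rejection from `γ_ij`. -/
def longRegion (c : ℝ) : Set (Fin n → E3) :=
  {t | ∀ e ∈ N.Egl c, 1 < inner ℝ (N.γ e.1 e.2) (t e.1 - t e.2)}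

lemma isOpen_longRegion (c : ℝ) : IsOpen (N.longRegion c) := by
  simp only [longRegion, Set.ofPred_forall]
  exact isOpen_biInter_finset fun e _ => isOpen_lt continuous_const (by fun_prop)

variable {N} {c : ℝ}

lemma γ_eq_γstar_of_mem_Egl {e : Fin n × Fin n} (he : e ∈ N.Egl c) :
    N.γ e.1 e.2 = N.γstar e.1 e.2 :=
  N.γ_good _ _ (Finset.mem_filter.1 he).1

lemma dilate_mem_longRegion (s : E3) : N.dilate c s ∈ N.longRegion c := by
  intro e he
  have hlong := (Finset.mem_filter.1 he).2
  have hne : N.loc e.1 ≠ N.loc e.2 := by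
    intro h
    rw [h, sub_self, norm_zero, mul_zero] at hlong
    exact hlong.not_ge zero_le_one
  rw [γ_eq_γstar_of_mem_Egl he, γstar, dilate_sub, ← norm_smul_direction (N.loc e.1), smul_smul,
    real_inner_smul_right, real_inner_self_eq_norm_sq, norm_direction hne, one_pow, mul_one]
  exact hlong

lemma eventually_dilate_add_smul_mem_longRegion (s : E3) (v : Fin n → E3) :
    ∀ᶠ τ : ℝ in nhdsWithin 0 (Set.Ioi 0), N.dilate c s + τ • v ∈ N.longRegion c := by
  have hcont : Continuous fun τ : ℝ => N.dilate c s + τ • v := by fun_prop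
  refine nhdsWithin_le_nhds (hcont.continuousAt ((N.isOpen_longRegion c).mem_nhds ?_))
  rw [zero_smul, add_zero]
  exact dilate_mem_longRegion s

lemma objective_dilate_add_le {c' : ℝ} {s' : E3} {δ : Fin n → E3}
    (hdilate : N.dilate c' s' ∈ N.longRegion c) (hδ : N.dilate c' s' + δ ∈ N.longRegion c) :
    N.objective (N.dilate c' s') + ∑ e ∈ N.Egl c, ‖projPerp (N.γstar e.1 e.2) (δ e.1 - δ e.2)‖ ≤
      N.objective (N.dilate c' s' + δ) + ∑ e ∈ N.EglCompl c, ‖δ e.1 - δ e.2‖ := by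
  set t := N.dilate c' s'
  have hbad : ∑ e ∈ N.EglCompl c, edgeCost (N.γ e.1 e.2) (t e.1) (t e.2) ≤
      ∑ e ∈ N.EglCompl c, edgeCost (N.γ e.1 e.2) ((t + δ) e.1) ((t + δ) e.2) +
        ∑ e ∈ N.EglCompl c, ‖δ e.1 - δ e.2‖ := by
    rw [← Finset.sum_add_distrib]
    exact Finset.sum_le_sum fun e he =>
      edgeCost_le_edgeCost_add (N.norm_γ e.1 e.2 (N.EglCompl_subset c he)) _ _ _ _
  have hrejection (e) (he : e ∈ N.Egl c) : rejection (N.γ e.1 e.2) (t e.1 - t e.2) = 0 := by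
    rw [γ_eq_γstar_of_mem_Egl he, γstar, rejection_direction, dilate_sub, map_smul, rejection_self,
      smul_zero]
  have hgood : ∑ e ∈ N.Egl c, edgeCost (N.γ e.1 e.2) (t e.1) (t e.2) = 0 :=
    Finset.sum_eq_zero fun e he => by
      rw [edgeCost_of_one_lt (hdilate e he), hrejection e he, norm_zero]
  have hgood_add : ∑ e ∈ N.Egl c, edgeCost (N.γ e.1 e.2) ((t + δ) e.1) ((t + δ) e.2) =
      ∑ e ∈ N.Egl c, ‖projPerp (N.γstar e.1 e.2) (δ e.1 - δ e.2)‖ :=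
    Finset.sum_congr rfl fun e he => by
      rw [edgeCost_of_one_lt (hδ e he), Pi.add_apply, Pi.add_apply, add_sub_add_comm, map_add,
        hrejection e he, zero_add, γ_eq_γstar_of_mem_Egl he]
      rfl
  rw [objective, objective, ← N.sum_EglCompl_add_sum_Egl c, ← N.sum_EglCompl_add_sum_Egl c, hgood,
    hgood_add]
  linarith

section Oracle

variable {s : E3}

lemma IsOracleSolution.sum_dilate (hcs : N.IsOracleSolution c s) : ∑ i, N.dilate c s i = 0 := hcs.1

lemma IsOracleSolution.objective_le (hcs : N.IsOracleSolution c s) {c' : ℝ} {s' : E3}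
    (hsum : ∑ i, N.dilate c' s' i = 0) :
    N.objective (N.dilate c s) ≤ N.objective (N.dilate c' s') :=
  hcs.2 c' s' hsum

/-- By convexity it is enough to compare the objectives a short way from the oracle solution towards
the competitor, and there the costs of the good and long edges are explicit. -/
lemma IsOracleSolution.objective_add_le (hcs : N.IsOracleSolution c s) {a : ℝ} {b : E3}
    (hab : ∑ i, N.dilate a b i = 0) (ε : Fin n → E3) :
    N.objective (N.dilate c s) + ∑ e ∈ N.Egl c, ‖projPerp (N.γstar e.1 e.2) (ε e.1 - ε e.2)‖ ≤
      N.objective (N.dilate c s + (N.dilate a b + ε)) + ∑ e ∈ N.EglCompl c, ‖ε e.1 - ε e.2‖ := by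
  obtain ⟨τ, ⟨hdilate, hε⟩, hτ₀, hτ₁⟩ := ((eventually_dilate_add_smul_mem_longRegion s
    (N.dilate a b)).and (eventually_dilate_add_smul_mem_longRegion s (N.dilate a b + ε))).and
      (Ioo_mem_nhdsGT one_pos) |>.exists
  rw [smul_add, ← add_assoc] at hε
  rw [← dilate_add_smul] at hdilate hε
  have hlocal := objective_dilate_add_le hdilate hε
  have horacle : N.objective (N.dilate c s) ≤ N.objective (N.dilate (c + τ * a) (s + τ • b)) := by
    refine hcs.objective_le ?_
    simp only [dilate_add_smul, Pi.add_apply, Pi.smul_apply, Finset.sum_add_distrib,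
      ← Finset.smul_sum, hab, hcs.sum_dilate, smul_zero, add_zero]
  have hconvex := N.convexOn_objective.2 (Set.mem_univ (N.dilate c s))
    (Set.mem_univ (N.dilate c s + (N.dilate a b + ε))) (sub_nonneg.2 hτ₁.le) hτ₀.le
    (sub_add_cancel 1 τ)
  have hsegment : (1 - τ) • N.dilate c s + τ • (N.dilate c s + (N.dilate a b + ε)) =
      N.dilate (c + τ * a) (s + τ • b) + τ • ε := by
    rw [dilate_add_smul]
    module
  rw [hsegment, smul_eq_mul, smul_eq_mul] at hconvex
  have hprojPerp (γ v : E3) : projPerp γ (τ • v) = τ • projPerp γ v := map_smul (rejection γ) τ v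
  simp only [Pi.smul_apply, ← smul_sub, hprojPerp, norm_smul, Real.norm_of_nonneg hτ₀.le,
    ← Finset.mul_sum] at hlocal
  refine le_of_mul_le_mul_left ?_ hτ₀
  linarith

lemma IsOracleSolution.objective_dilate_lt (hcs : N.IsOracleSolution c s)
    (hunique : ∀ (c' : ℝ) (s' : E3), N.IsOracleSolution c' s' → c' = c) {c' : ℝ} {s' : E3}
    (hsum : ∑ i, N.dilate c' s' i = 0) (hne : N.dilate c' s' ≠ N.dilate c s) :
    N.objective (N.dilate c s) < N.objective (N.dilate c' s') := by
  refine (hcs.objective_le hsum).lt_of_ne fun heq => hne ?_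
  obtain rfl : c' = c := hunique c' s' ⟨hsum, fun c'' s'' h => heq.ge.trans (hcs.objective_le h)⟩
  ext1 i
  have hn : (n : ℝ) ≠ 0 := Nat.cast_ne_zero.2 i.pos.ne'
  have hshift : (n : ℝ) • (s' - s) = ∑ i, (N.dilate c' s' i - N.dilate c' s i) := by
    simp only [dilate, add_sub_add_left_eq_sub, Finset.sum_const, Finset.card_univ,
      Fintype.card_fin, Nat.cast_smul_eq_nsmul]
  rw [Finset.sum_sub_distrib, hsum, hcs.sum_dilate, sub_zero, smul_eq_zero_iff_right hn,
    sub_eq_zero] at hshift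
  rw [hshift]

lemma IsOracleSolution.objective_lt (hcs : N.IsOracleSolution c s)
    (hunique : ∀ (c' : ℝ) (s' : E3), N.IsOracleSolution c' s' → c' = c)
    (hdom : N.StrictDominance c) {u : Fin n → E3} (hu : ∑ i, u i = 0) (hne : u ≠ N.dilate c s) :
    N.objective (N.dilate c s) < N.objective u := by
  have hcentred : ∑ i, (u i - N.dilate c s i) = 0 := by
    rw [Finset.sum_sub_distrib, hu, hcs.sum_dilate, sub_zero]
  obtain ⟨a, b, ε, hdecomp, hε, hεl⟩ := exists_dilation_add N.loc hcentred
  have hab : ∑ i, N.dilate a b i = 0 := by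
    simp only [hdecomp, Finset.sum_add_distrib, hε, add_zero] at hcentred
    simpa only [dilate, Finset.sum_add_distrib] using hcentred
  obtain rfl : u = N.dilate c s + (N.dilate a b + ε) :=
    funext fun i => (add_eq_of_eq_sub' (hdecomp i).symm).symm
  rcases eq_or_ne ε 0 with rfl | hε_ne
  · have hdilate : N.dilate c s + (N.dilate a b + 0) = N.dilate (c + a) (s + b) := by
      simpa only [one_mul, one_smul, add_zero] using (N.dilate_add_smul c a 1 s b).symm
    rw [hdilate] at hu hne ⊢
    exact hcs.objective_dilate_lt hunique hu hne
  · linarith [hcs.objective_add_le hab ε, hdom ε hε hεl hε_ne]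

theorem IsOracleSolution.isLUDSolution_iff (hcs : N.IsOracleSolution c s)
    (hunique : ∀ (c' : ℝ) (s' : E3), N.IsOracleSolution c' s' → c' = c)
    (hdom : N.StrictDominance c) {t : Fin n → E3} :
    N.IsLUDSolution t ↔ ∀ i, t i = c • N.loc i + s := by
  have hiff : (∀ i, t i = c • N.loc i + s) ↔ t = N.dilate c s := funext_iff.symm
  rw [hiff]
  constructor
  · intro ht
    by_contra hne
    exact (hcs.objective_lt hunique hdom ht.1 hne).not_ge (ht.2 _ hcs.sum_dilate)
  · rintro rfl
    refine ⟨hcs.sum_dilate, fun u hu => ?_⟩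
    rcases eq_or_ne u (N.dilate c s) with rfl | hne
    exacts [le_rfl, (hcs.objective_lt hunique hdom hu hne).le]

end Oracle

end CameraNetwork

end LUD

theorem theorem3_general {n : ℕ} (N : LUD.CameraNetwork n) {c : ℝ} {s : LUD.E3}
    (hcs : N.IsOracleSolution c s)
    (hunique : ∀ (c' : ℝ) (s' : LUD.E3), N.IsOracleSolution c' s' → c' = c)
    {p β ε₀ ε₁ c₀ c₁ : ℝ} (hp : 0 < p) (hβ : 0 < β) (hc₁ : 0 < c₁) (hc₀ : 1 ≤ c₀)
    (hshape : LUD.WeakGoodShape N c p β ε₀ ε₁ c₀ c₁)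
    (hε₀ : ε₀ ≤ min (β * c₁ * p / (2 ^ 14 * c₀ ^ 2))
      (min (β * c₁ ^ 2 * p / (2 ^ 11 * c₀)) (c₁ * p ^ 2 / 16)))
    (hε₁ : ε₁ ≤ 1 / 12) :
    N.GoodLongDominance c ∧
      ∀ t : Fin n → LUD.E3, N.IsLUDSolution t ↔ ∀ i, t i = c • N.loc i + s := by
  obtain ⟨hε₀₁, hε₀₂, hε₀₃⟩ := by simpa only [le_min_iff] using hε₀
  have hdom := hshape.strictDominance hp hβ hc₁ hc₀ hε₀₁ hε₀₂ hε₀₃ hε₁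
  exact ⟨hdom.goodLongDominance, fun _ => hcs.isLUDSolution_iff hunique hdom⟩

theorem theorem3 {n : ℕ} (N : LUD.CameraNetwork n)
    -- the scale and shift solving the oracle problem, with unique scale
    (c : ℝ) (s : LUD.E3) (hcs : N.IsOracleSolution c s)
    (hunique : ∀ (c' : ℝ) (s' : LUD.E3), N.IsOracleSolution c' s' → c' = c)
    -- the parameters
    (p β ε₀ ε₁ c₀ c₁ : ℝ)
    (hp : p ∈ Set.Ioc (0 : ℝ) 1) (hβ : β ∈ Set.Ioc (0 : ℝ) 1)
    (hε₀ : ε₀ ∈ Set.Ioc (0 : ℝ) 1) (hε₁ : ε₁ ∈ Set.Ioc (0 : ℝ) 1)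
    (hc₁ : c₁ ∈ Set.Ioc (0 : ℝ) 1) (hc₀ : 1 ≤ c₀)
    (hshape : LUD.GoodShape N c p β ε₀ ε₁ c₀ c₁)
    (hε₀_le : ε₀ ≤ min (β * c₁ * p / (2 ^ 22 * c₀ ^ 3))
      (min (β * c₁ ^ 2 * p / (2 ^ 20 * c₀)) (c₁ * p ^ 2 / 16)))
    (hε₁_le : ε₁ ≤ min (1 / (144 * c₀)) (1 / 96)) :
    N.GoodLongDominance c ∧
      ∀ t : Fin n → LUD.E3, N.IsLUDSolution t ↔ ∀ i, t i = c • N.loc i + s := by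
  have ⟨hp, hβ, hc₁⟩ := And.intro hp.1 (And.intro hβ.1 hc₁.1)
  exact theorem3_general N hcs hunique hp hβ hc₁ hc₀ hshape.weakGoodShape
    (hε₀_le.trans (by gcongr <;> norm_num)) (hε₁_le.trans (by norm_num))
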